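/- **Setting.** Let $n\ge 1$, $b>0$, $D>0$. Consider the plant $$\dot X(t)=AX(t)+BU(t-D)+Gd(t),\qquad Y(t)=CX(t),\qquad X(t)\in\mathbb R^n,$$ where $A$ is strict-feedback (entries $a_{i,j}$ for $j\le i$, ones on the superdiagonal, zeros above it), $B=(0,\dots,0,b)^\top$, $C=(1,0,\dots,0)$, and $U(s)=0$ for $s\le 0$ as far as the delayed input is concerned. The disturbance and the reference are $d=\bar P_dV$, $r=\bar P_rV$ with $\dot V=SV$, $V=(V_d,V_r)\in\mathbb R^{n_v}$, $S=\operatorname{diag}(S_d,S_r)$, $\bar P_d=(P_d,0)$, $\bar P_r=(0,P_r)$, where all eigenvalues of $S$ lie on the imaginary axis and $S$ is diagonalizable over $\mathbb C$. Put $e=Y-r$, $\bar G=G\bar P_d$ with rows $g_1,\dots,g_n$, and, for $x\in[0,1]$, $t\ge 0$, let $u(x,t)=U(t-D+Dx)$ if $t-D+Dx>0$ and $u(x,t)=0$ otherwise. **Barrier.** Let $h:\mathbb R\times[0,\infty)\to\mathbb R$ be $n$ times continuously differentiable with $\vartheta:=\partial h/\partial e\ne0$ everywhere, both uniformly up to $t=\infty$: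 for every $M$, on $\{|e|\le M,\ t\ge0\}$ all partial derivatives of $h$ of orders $1,\dots,n$ are bounded and $|\vartheta|$ is bounded below by a positive constant. Suppose that for every $M$ there is $R$ such that $|h(e,t)|\le M$ implies $|e|\le R$ for all $e$ and all $t\ge0$, and that for every $e:[0,\infty)\to\mathbb R$, $h(e(t),t)\to0$ as $t\to\infty$ implies $e(t)\to0$. **Transformations.** Let $\varrho_{0,\cdot}=0$, $\varrho_{i,l}=0$ unless $1\le l\le i$, and $\varrho_{i,l}=a_{i,l}+\varrho_{i-1,l-1}+\sum_{j=l}^{i-1}\varrho_{i-1,j}a_{j,l}$ for $1\le l\le i\le n$; let $\sigma_0=0$, $\sigma_i=-\sum_{j=1}^{i-1}\varrho_{i-1,j}g_j-g_i+\sigma_{i-1}S$. Let $T_z$ be the unit lower triangular matrix with $i$-th row $(\varrho_{i-1,1},\dots,\varrho_{i-1,i-1},1,0,\dots,0)$, let $T_v$ have $i$-th row $-(\sigma_{i-1}+\bar P_rS^{i-1})$, and let $K=\frac1b(\varrho_{n,1},\dots,\varrho_{n,n})$, $G_0=-\frac1b(\sigma_n+\bar P_rS^n)$. Put $Z=(z_1,\dots,z_n)^\top=T_zX+T_vV$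 (so $z_1=e$). The predicted state is $$X(t+D)=e^{DA}X(t)+\int_0^1De^{DA(1-y)}Bu(y,t)\,dy+\int_0^1De^{DA(1-y)}\bar Ge^{DSy}V(t)\,dy,$$ and $V(t+D)=e^{DS}V(t)$, $Z(t+D)=T_zX(t+D)+T_vV(t+D)$; at $t=0$ these give $Z(D)$ and $e(D)=z_1(D)$ in terms of the initial data. For parameters $\epsilon,\bar t>0$ let $\varsigma\equiv0$ if $h(e(D),D)>0$, and otherwise $\varsigma(t)=(-h(e(D),D)+\epsilon)\exp\!\big(\tfrac1{\bar t^2}-\tfrac1{(t-D-\bar t)^2}\big)$ for $t<D+\bar t$, $\varsigma(t)=0$ for $t\ge D+\bar t$. For gains $k_1,\dots,k_n$ let $h_1(z_1,t)=h(z_1,t)+\varsigma(t)$ and $$h_{i}=\sum_{j=1}^{i-1}\frac{\partial h_{i-1}}{\partial z_j}z_{j+1}+\frac{\partial h_{i-1}}{\partial t}+k_{i-1}h_{i-1}\quad(2\le i\le n),\qquad f=\frac1b\Big(\sum_{j=1}^{n-1}\frac{\partial h_n}{\partial z_j}z_{j+1}+\frac{\partial h_n}{\partial t}+k_nh_n\Big).$$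 **Controller.** For $t\ge0$, $$U(t)=-\int_0^1DKe^{DA(1-y)}Bu(y,t)\,dy-Ke^{DA}X(t)-\Big(\int_0^1DKe^{DAy}\bar Ge^{DS(1-y)}dy+G_0e^{DS}\Big)V(t)-\frac{f(Z(t+D),t+D)}{\vartheta(z_1(t+D),t+D)}.$$ **Gains.** Assume $k_i>0$ for $i=1,\dots,n$ and $k_i\ge\max\{0,\hat k_i\}$ for $i=1,\dots,n-1$, where $$\hat k_i=\frac{-1}{h_i}\Big(\sum_{j=1}^i\frac{\partial h_i}{\partial z_j}z_{j+1}+\frac{\partial h_i}{\partial t}\Big)\Big|_{(Z(D),D)}$$ (the bound by $\hat k_i$ is void if $h_i$ vanishes at $(Z(D),D)$). **Claim.** For all initial data $X(0)\in\mathbb R^n$, $V(0)\in\mathbb R^{n_v}$ and every solution of the closed-loop system on an interval $[0,T)$, $0<T\le\infty$, the states $X(t)$, $V(t)$ and $u(x,t)$ ($x\in[0,1]$) are bounded on $[0,T)$; and if $T=\infty$, then $e(t)\to0$ as $t\to\infty$. -/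

import Mathlib

open Set Filter Topology MeasureTheory Matrix
open scoped BigOperators

namespace DelaySafe

noncomputable section

/-- Data of the plant `X' = A X + B U(t - D) + G d`, `Y = x₁`, of the disturbance model
`V_d' = S_d V_d`, `d = P_d V_d` and of the reference model `V_r' = S_r V_r`, `r = P_r V_r`.
Only the entries of `a` on and below the diagonal matter, see `Plant.A`. -/
structure Plant (n m nd nr : ℕ) where
  a : Matrix (Fin n) (Fin n) ℝ
  b : ℝ
  D : ℝ
  G : Matrix (Fin n) (Fin m) ℝ
  Pd : Matrix (Fin m) (Fin nd) ℝ
  Sd : Matrix (Fin nd) (Fin nd) ℝ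
  Pr : Fin nr → ℝ
  Sr : Matrix (Fin nr) (Fin nr) ℝ

namespace Plant

variable {n m nd nr : ℕ} (P : Plant n m nd nr)

/-- The lower Hessenberg (strict-feedback) system matrix: entries `a i j` on and below the
diagonal, ones on the superdiagonal, zeros elsewhere. -/
def A : Matrix (Fin n) (Fin n) ℝ := Matrix.of fun i j =>
  if j ≤ i then P.a i j else if (j : ℕ) = i + 1 then 1 else 0

/-- `B = (0, …, 0, b)ᵀ`. -/
def B : Fin n → ℝ := fun i => if (i : ℕ) + 1 = n then P.b else 0

/-- `C = (1, 0, …, 0)`. -/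
def C (_P : Plant n m nd nr) : Fin n → ℝ := fun i => if (i : ℕ) = 0 then 1 else 0

/-- `S = diag(S_d, S_r)`. -/
def S : Matrix (Fin nd ⊕ Fin nr) (Fin nd ⊕ Fin nr) ℝ := Matrix.fromBlocks P.Sd 0 0 P.Sr

/-- `(P_d, 0)`, so that `d = PdBar V`. -/
def PdBar : Matrix (Fin m) (Fin nd ⊕ Fin nr) ℝ := Matrix.fromCols P.Pd 0

/-- `(0, P_r)`, so that `r = PrBar V`. -/
def PrBar : Fin nd ⊕ Fin nr → ℝ := Sum.elim 0 P.Pr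

/-- `G (P_d, 0)`. -/
def GBar : Matrix (Fin n) (Fin nd ⊕ Fin nr) ℝ := P.G * P.PdBar

/-- The exogenous matrix `S` has all its eigenvalues on the imaginary axis and is
diagonalizable over `ℂ` (so that it generates constant and trigonometric signals). -/
def ExoOscillatory : Prop :=
  (∀ μ ∈ spectrum ℂ (P.S.map (algebraMap ℝ ℂ)), μ.re = 0) ∧
    Module.End.IsSemisimple (Matrix.toLin' (P.S.map (algebraMap ℝ ℂ)))

/-- `aEntry i j = a_{i,j}` with indices running from `1` to `n`. -/
def aEntry (i j : ℕ) : ℝ :=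
  if hij : (1 ≤ i ∧ i ≤ n) ∧ (1 ≤ j ∧ j ≤ n) then
    P.a ⟨i - 1, by omega⟩ ⟨j - 1, by omega⟩ else 0

/-- `gRow i = g_i`, the `i`-th row of `GBar`, `i = 1, …, n`. -/
def gRow (i : ℕ) : Fin nd ⊕ Fin nr → ℝ :=
  if hi : 1 ≤ i ∧ i ≤ n then P.GBar ⟨i - 1, by omega⟩ else 0

/-- The constants `ϱ_{i,j}`, `1 ≤ j ≤ i` (zero for all other indices):
`ϱ_{i,l} = a_{i,l} + ϱ_{i-1,l-1} + ∑_{j=l}^{i-1} ϱ_{i-1,j} a_{j,l}`. -/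
def rho : ℕ → ℕ → ℝ
  | 0, _ => 0
  | i + 1, l =>
    if 1 ≤ l ∧ l ≤ i + 1 then
      P.aEntry (i + 1) l + rho i (l - 1) + ∑ j ∈ Finset.Icc l i, rho i j * P.aEntry j l
    else 0

/-- The row vectors `σ_0 = 0`, `σ_i = - ∑_{j=1}^{i-1} ϱ_{i-1,j} g_j - g_i + σ_{i-1} S`. -/
def sigma : ℕ → (Fin nd ⊕ Fin nr → ℝ)
  | 0 => 0
  | i + 1 =>
    -(∑ j ∈ Finset.Icc 1 i, P.rho i j • P.gRow j) - P.gRow (i + 1) + sigma i ᵥ* P.S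

/-- `T_z`: unit lower triangular; its row number `i` is `(ϱ_{i-1,1}, …, ϱ_{i-1,i-1}, 1, 0, …)`
(rows numbered from `1`). -/
def Tz : Matrix (Fin n) (Fin n) ℝ := Matrix.of fun i j =>
  if j = i then 1 else if j < i then P.rho i (j + 1) else 0

/-- `T_v`: its row number `i` is `-(σ_{i-1} + P_r S^{i-1})` (rows numbered from `1`). -/
def Tv : Matrix (Fin n) (Fin nd ⊕ Fin nr) ℝ := Matrix.of fun i =>
  -(P.sigma i + P.PrBar ᵥ* P.S ^ (i : ℕ))

/-- `K = (ϱ_{n,1}, …, ϱ_{n,n}) / b`. -/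
def K : Fin n → ℝ := fun j => (1 / P.b) * P.rho n (j + 1)

/-- `G₀ = -(σ_n + P_r S^n) / b`. -/
def G0 : Fin nd ⊕ Fin nr → ℝ := -((1 / P.b) • (P.sigma n + P.PrBar ᵥ* P.S ^ n))

/-- `e^{τ A}`. -/
def expA (τ : ℝ) : Matrix (Fin n) (Fin n) ℝ := NormedSpace.exp (τ • P.A)

/-- `e^{τ S}`. -/
def expS (τ : ℝ) : Matrix (Fin nd ⊕ Fin nr) (Fin nd ⊕ Fin nr) ℝ := NormedSpace.exp (τ • P.S)

/-- The prediction of the plant state `τ ∈ [0, D]` time units ahead, from the current plant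
state `x`, exogenous state `v` and actuator state `u : [0, 1] → ℝ`. -/
def predX (x : Fin n → ℝ) (v : Fin nd ⊕ Fin nr → ℝ) (u : ℝ → ℝ) (τ : ℝ) : Fin n → ℝ :=
  P.expA τ *ᵥ x
    + (∫ y in (0 : ℝ)..(τ / P.D), (P.D * u y) • (P.expA (P.D * (τ / P.D - y)) *ᵥ P.B))
    + ∫ y in (0 : ℝ)..(τ / P.D),
        P.D • (P.expA (P.D * (τ / P.D - y)) *ᵥ (P.GBar *ᵥ (P.expS (P.D * y) *ᵥ v)))

/-- The prediction of `Z = T_z X + T_v V`, `τ` time units ahead, as a sequence indexed from `1`: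
the values at `1, …, n` are `z_1, …, z_n`. -/
def predZ (x : Fin n → ℝ) (v : Fin nd ⊕ Fin nr → ℝ) (u : ℝ → ℝ) (τ : ℝ) (j : ℕ) : ℝ :=
  if hj : 1 ≤ j ∧ j ≤ n then
    (P.Tz *ᵥ P.predX x v u τ + P.Tv *ᵥ (P.expS τ *ᵥ v)) ⟨j - 1, by omega⟩ else 0

/-- The tracking error `e = Y - r = C X - P_r V_r`. -/
def err (x : Fin n → ℝ) (v : Fin nd ⊕ Fin nr → ℝ) : ℝ := P.C ⬝ᵥ x - P.PrBar ⬝ᵥ v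

/-- `h(e(D), D)`, computed from the initial data (no input reaches the plant before `D`). -/
def hAtD (h : ℝ → ℝ → ℝ) (x₀ : Fin n → ℝ) (v₀ : Fin nd ⊕ Fin nr → ℝ) : ℝ :=
  h (P.err (P.predX x₀ v₀ 0 P.D) (P.expS P.D *ᵥ v₀)) P.D

end Plant

/-- `∂h/∂e`. -/
def vartheta (h : ℝ → ℝ → ℝ) (e t : ℝ) : ℝ := deriv (fun s => h s t) e

/-- The assumption on the barrier function `h(e, t)`, `e ∈ ℝ`, `t ∈ [0, ∞]`. The fields `deriv_bdd`
and `deriv_away` say what `n`-fold differentiability and `∂h/∂e ≠ 0` mean up to `t = ∞`. -/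
structure IsBarrier (n : ℕ) (h : ℝ → ℝ → ℝ) : Prop where
  smooth : ContDiffOn ℝ n (Function.uncurry h) (univ ×ˢ Ici 0)
  deriv_ne_zero : ∀ e t : ℝ, 0 ≤ t → vartheta h e t ≠ 0
  /-- for bounded `e`, the derivatives of `h` of orders `1, …, n` are bounded uniformly in time -/
  deriv_bdd : ∀ M : ℝ, ∃ c : ℝ, ∀ e t : ℝ, |e| ≤ M → 0 < t → ∀ i : ℕ, 1 ≤ i → i ≤ n →
    ‖iteratedFDeriv ℝ i (Function.uncurry h) (e, t)‖ ≤ c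
  /-- for bounded `e`, `∂h/∂e` stays away from zero uniformly in time -/
  deriv_away : ∀ M : ℝ, ∃ c : ℝ, 0 < c ∧ ∀ e t : ℝ, |e| ≤ M → 0 ≤ t → c ≤ |vartheta h e t|
  /-- a bound for `h(e, t)` gives a bound for `e` -/
  bdd_of_bdd : ∀ M : ℝ, ∃ R : ℝ, ∀ e t : ℝ, 0 ≤ t → |h e t| ≤ M → |e| ≤ R
  /-- `h(e(t), t) → 0` implies `e(t) → 0` -/
  tendsto_of_tendsto : ∀ e : ℝ → ℝ,
    Tendsto (fun t => h (e t) t) atTop (𝓝 0) → Tendsto e atTop (𝓝 0)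

/-- The recovery function `ς(t)`, where `h₀` stands for `h(e(D), D)`. -/
def recovery (D h₀ ε tbar t : ℝ) : ℝ :=
  if h₀ ≤ 0 then
    if t < D + tbar then (-h₀ + ε) * Real.exp (1 / tbar ^ 2 - 1 / (t - D - tbar) ^ 2) else 0
  else 0

/-- `∂F/∂z_j` for a function `F` of `z = (z_1, z_2, …)` and `t`. -/
def pderivZ (F : (ℕ → ℝ) → ℝ → ℝ) (j : ℕ) (z : ℕ → ℝ) (t : ℝ) : ℝ :=
  deriv (fun s => F (Function.update z j s) t) (z j)

/-- `∂F/∂t`. -/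
def pderivT (F : (ℕ → ℝ) → ℝ → ℝ) (z : ℕ → ℝ) (t : ℝ) : ℝ := deriv (fun s => F z s) t

/-- The functions `h_1 = h + ς`,
`h_{i+1} = ∑_{j=1}^{i} (∂h_i/∂z_j) z_{j+1} + ∂h_i/∂t + k_i h_i`, numbered from `1`. -/
def cbf (h : ℝ → ℝ → ℝ) (s : ℝ → ℝ) (k : ℕ → ℝ) : ℕ → (ℕ → ℝ) → ℝ → ℝ
  | 0 => fun _ _ => 0
  | 1 => fun z t => h (z 1) t + s t
  | i + 2 => fun z t =>
      (∑ j ∈ Finset.Icc 1 (i + 1), pderivZ (cbf h s k (i + 1)) j z t * z (j + 1))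
        + pderivT (cbf h s k (i + 1)) z t + k (i + 1) * cbf h s k (i + 1) z t

/-- `f = (1/b) (∑_{j=1}^{n-1} (∂h_n/∂z_j) z_{j+1} + ∂h_n/∂t + k_n h_n)`. -/
def driftTerm (n : ℕ) (b : ℝ) (h : ℝ → ℝ → ℝ) (s : ℝ → ℝ) (k : ℕ → ℝ) (z : ℕ → ℝ) (t : ℝ) : ℝ :=
  (1 / b) * ((∑ j ∈ Finset.Icc 1 (n - 1), pderivZ (cbf h s k n) j z t * z (j + 1))
    + pderivT (cbf h s k n) z t + k n * cbf h s k n z t)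

namespace Plant

variable {n m nd nr : ℕ} (P : Plant n m nd nr)

/-- The nominal controller, as a feedback of the plant state `x`, the exogenous state `v`, the
actuator state `u : [0, 1] → ℝ` and the time `t`. -/
def control (h : ℝ → ℝ → ℝ) (s : ℝ → ℝ) (k : ℕ → ℝ)
    (x : Fin n → ℝ) (v : Fin nd ⊕ Fin nr → ℝ) (u : ℝ → ℝ) (t : ℝ) : ℝ :=
  -(∫ y in (0 : ℝ)..1, P.D * (P.K ⬝ᵥ (P.expA (P.D * (1 - y)) *ᵥ P.B)) * u y)
    - P.K ⬝ᵥ (P.expA P.D *ᵥ x)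
    - ((∫ y in (0 : ℝ)..1,
          P.D * (P.K ⬝ᵥ (P.expA (P.D * y) *ᵥ (P.GBar *ᵥ (P.expS (P.D * (1 - y)) *ᵥ v)))))
        + P.G0 ⬝ᵥ (P.expS P.D *ᵥ v))
    + -(driftTerm n P.b h s k (P.predZ x v u P.D) (t + P.D)
        / vartheta h (P.predZ x v u P.D 1) (t + P.D))

/-- The recovery function determined by the initial data. -/
def varsigma (h : ℝ → ℝ → ℝ) (ε tbar : ℝ) (x₀ : Fin n → ℝ) (v₀ : Fin nd ⊕ Fin nr → ℝ) : ℝ → ℝ :=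
  recovery P.D (P.hAtD h x₀ v₀) ε tbar

/-- The lower gain bound
`k̂_i = -(1/h_i) (∑_{j=1}^{i} (∂h_i/∂z_j) z_{j+1} + ∂h_i/∂t)`, evaluated at `(Z(D), D)`. -/
def kHat (h : ℝ → ℝ → ℝ) (s : ℝ → ℝ) (k : ℕ → ℝ)
    (x₀ : Fin n → ℝ) (v₀ : Fin nd ⊕ Fin nr → ℝ) (i : ℕ) : ℝ :=
  let z := P.predZ x₀ v₀ 0 P.D
  (-1 / cbf h s k i z P.D) *
    ((∑ j ∈ Finset.Icc 1 i, pderivZ (cbf h s k i) j z P.D * z (j + 1))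
      + pderivT (cbf h s k i) z P.D)

/-- The actuator state `u(x, t)`, i.e. the transport equation `D u_t = u_x`, `u(1, t) = U(t)`,
`u(x, 0) = 0` solved explicitly. In particular `u(0, t) = U(t - D)` for `t > D`. -/
def actuator (U : ℝ → ℝ) (x t : ℝ) : ℝ :=
  if 0 < t - P.D + P.D * x then U (t - P.D + P.D * x) else 0

/-- `X`, `V`, `U` are a solution on `[0, T)`, `T ∈ (0, ∞]`, of the closed loop formed by the
plant, the exogenous model and the nominal controller. `X` is not differentiable at `t = D` in
general, where the input signal starts to act on the plant. -/
structure IsClosedLoop (h : ℝ → ℝ → ℝ) (k : ℕ → ℝ) (ε tbar : ℝ)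
    (x₀ : Fin n → ℝ) (v₀ : Fin nd ⊕ Fin nr → ℝ) (T : EReal)
    (X : ℝ → Fin n → ℝ) (V : ℝ → Fin nd ⊕ Fin nr → ℝ) (U : ℝ → ℝ) : Prop where
  X_zero : X 0 = x₀
  V_zero : V 0 = v₀
  V_ode : ∀ t : ℝ, 0 ≤ t → (t : EReal) < T → HasDerivWithinAt V (P.S *ᵥ V t) (Ici 0) t
  X_cont : ∀ t : ℝ, 0 ≤ t → (t : EReal) < T → ContinuousWithinAt X (Ici 0) t
  X_ode : ∀ t : ℝ, 0 < t → (t : EReal) < T → t ≠ P.D →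
    HasDerivAt X (P.A *ᵥ X t + P.actuator U 0 t • P.B + P.G *ᵥ (P.PdBar *ᵥ V t)) t
  U_int : ∀ t : ℝ, 0 ≤ t → (t : EReal) < T → IntervalIntegrable U volume 0 t
  U_law : ∀ t : ℝ, 0 ≤ t → (t : EReal) < T →
    U t = P.control h (P.varsigma h ε tbar x₀ v₀) k (X t) (V t) (fun y => P.actuator U y t) t

end Plant

end

end DelaySafe

/-! ### Calculus of functions of the chain coordinates and time. -/

namespace DelaySafe

/-! The predictor compensates the delay exactly. The plant and the exogenous system are linear, so
variation of constants writes `X` as an explicit `response` to `U`, and the predicted state at time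
`t` is this response at `s = t + D` (`predX_response`). In the variable `s`, which runs over `[D, T
+ D)`, the controller is therefore an undelayed static feedback.

The coordinates `Z` turn the plant into a chain of integrators (`chainCoord_plant`). The terms with
`K` and `G0` cancel the drift of the last integrator (`mul_K_add_G0`), and what remains of the
feedback is `z_n' = -b f / ϑ`. The coefficient of `z_i` in `h_i` is always `ϑ` (`pderivZ_cbf`), so
the closed loop becomes the cascade `h_i' = -k_i h_i + h_{i+1}` for `i < n`, closed by `h_n' = -k_n
h_n`. As all `k_i` are positive, every `h_i` decays exponentially (`exists_cbf_decay`).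

Boundedness climbs back up the cascade (`exists_bound_of_cbf_bound`). A bound on `h_1` bounds
`h(z_1, s)`, hence `z_1`; then `h_{i+1} = (terms in z_1, …, z_i) + ϑ z_{i+1}`, with `ϑ` away from
zero, bounds the next coordinate. The flow of `S` is bounded by diagonalizability, `T_z` is
invertible, and so the state and the input are bounded. After the recovery function has vanished,
`h_1` is `h(e, s)`, so its decay forces `e → 0`.

Regularity is tracked by `IsRegular`: each passage from `h_i` to `h_{i+1}` spends one of the `n`
derivatives of `h`, and `f` spends the last one. -/

lemma exists_bound_of_continuous_of_eq_zero {s : ℝ → ℝ} (hs : Continuous s)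
    (hs0 : ∃ c, ∀ t, c < t → s t = 0) : ∃ C, ∀ t, 0 < t → |s t| ≤ C := by
  obtain ⟨c, hc⟩ := hs0
  obtain ⟨C, hC⟩ := (isCompact_Icc (a := 0) (b := c)).exists_bound_of_continuousOn hs.continuousOn
  refine ⟨max C 0, fun t ht => ?_⟩
  by_cases htc : t ≤ c
  · exact (hC t ⟨ht.le, htc⟩).trans (le_max_left _ _)
  · simp [hc t (not_le.1 htc)]

/-- `F z t` stays bounded and continuous, for `t > 0`, in terms of bounds for `z 1, …, z N` and
`h (z 1) t`. -/
structure IsTame (h : ℝ → ℝ → ℝ) (N : ℕ) (F : (ℕ → ℝ) → ℝ → ℝ) : Prop where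
  bdd : ∀ M : ℝ, ∃ c : ℝ, ∀ z t, 0 < t → |h (z 1) t| ≤ M → (∀ j ∈ Finset.Icc 1 N, |z j| ≤ M) →
    |F z t| ≤ c
  cont : ContinuousOn (Function.uncurry F) (univ ×ˢ Ioi 0)

/-- `Fz` and `Ft` are the partial derivatives of `F`, a function of `z 1, …, z N` and `t > 0`, in
the sense of the chain rule along curves. -/
def HasPartials (N : ℕ) (F : (ℕ → ℝ) → ℝ → ℝ) (Fz : ℕ → (ℕ → ℝ) → ℝ → ℝ)
    (Ft : (ℕ → ℝ) → ℝ → ℝ) : Prop :=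
  ∀ (z : ℝ → ℕ → ℝ) (z' : ℕ → ℝ) (τ : ℝ → ℝ) (τ' s : ℝ), 0 < τ s →
    (∀ j ∈ Finset.Icc 1 N, HasDerivAt (fun r => z r j) (z' j) s) → HasDerivAt τ τ' s →
    HasDerivAt (fun r => F (z r) (τ r))
      (∑ j ∈ Finset.Icc 1 N, Fz j (z s) (τ s) * z' j + Ft (z s) (τ s) * τ') s

/-- `F` is a function of `z 1, …, z N` and `t > 0` which is tame together with its partial
derivatives up to order `r`. -/
def IsRegular (h : ℝ → ℝ → ℝ) (N : ℕ) : ℕ → ((ℕ → ℝ) → ℝ → ℝ) → Prop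
  | 0, F => IsTame h N F
  | r + 1, F => IsTame h N F ∧ ∃ (Fz : ℕ → (ℕ → ℝ) → ℝ → ℝ) (Ft : (ℕ → ℝ) → ℝ → ℝ),
      HasPartials N F Fz Ft ∧ (∀ j, IsRegular h N r (Fz j)) ∧ IsRegular h N r Ft ∧
      ∀ j, j ∉ Finset.Icc 1 N → Fz j = 0

variable {h : ℝ → ℝ → ℝ} {N r : ℕ} {F G : (ℕ → ℝ) → ℝ → ℝ}

namespace IsTame

lemma congr (hF : IsTame h N F) (hFG : ∀ z t, 0 < t → F z t = G z t) : IsTame h N G where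
  bdd M := by
    obtain ⟨c, hc⟩ := hF.bdd M
    exact ⟨c, fun z t ht h1 h2 => hFG z t ht ▸ hc z t ht h1 h2⟩
  cont := hF.cont.congr fun p hp => (hFG p.1 p.2 hp.2).symm

lemma mono (hF : IsTame h N F) {N' : ℕ} (hN : N ≤ N') : IsTame h N' F where
  bdd M := by
    obtain ⟨c, hc⟩ := hF.bdd M
    exact ⟨c, fun z t ht h1 h2 => hc z t ht h1 fun j hj => h2 j (Finset.Icc_subset_Icc_right hN hj)⟩
  cont := hF.cont

lemma add (hF : IsTame h N F) (hG : IsTame h N G) :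
    IsTame h N fun z t => F z t + G z t where
  bdd M := by
    obtain ⟨c, hc⟩ := hF.bdd M
    obtain ⟨d, hd⟩ := hG.bdd M
    exact ⟨c + d, fun z t ht h1 h2 => (abs_add_le _ _).trans
      (add_le_add (hc z t ht h1 h2) (hd z t ht h1 h2))⟩
  cont := hF.cont.add hG.cont

lemma mul (hF : IsTame h N F) (hG : IsTame h N G) :
    IsTame h N fun z t => F z t * G z t where
  bdd M := by
    obtain ⟨c, hc⟩ := hF.bdd M
    obtain ⟨d, hd⟩ := hG.bdd M
    refine ⟨c * d, fun z t ht h1 h2 => ?_⟩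
    rw [abs_mul]
    exact mul_le_mul (hc z t ht h1 h2) (hd z t ht h1 h2) (abs_nonneg _)
      ((abs_nonneg _).trans (hc z t ht h1 h2))
  cont := hF.cont.mul hG.cont

lemma const (c : ℝ) : IsTame h N fun _ _ => c where
  bdd _ := ⟨|c|, fun _ _ _ _ _ => le_rfl⟩
  cont := continuousOn_const

lemma coord {j : ℕ} (hj : j ∈ Finset.Icc 1 N) : IsTame h N fun z _ => z j where
  bdd M := ⟨M, fun _ _ _ _ h2 => h2 j hj⟩
  cont := ((continuous_apply j).comp continuous_fst).continuousOn

end IsTame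

/-- The chain rule along a coordinate line shows that the abstract partial derivatives must be the
concrete ones. Only positive times are covered, as nothing is known about `h` at negative times. -/
lemma HasPartials.pderivZ {Fz Ft} (hF : HasPartials N F Fz Ft) (j : ℕ) (z : ℕ → ℝ) {t : ℝ}
    (ht : 0 < t) : pderivZ F j z t = if j ∈ Finset.Icc 1 N then Fz j z t else 0 := by
  have hz : ∀ l, HasDerivAt (fun s => Function.update z j s l) (if l = j then 1 else 0) (z j) := by
    intro l
    by_cases hl : l = j
    · subst hl
      simpa using hasDerivAt_id' (z l)
    · simpa [Function.update_of_ne hl, hl] using hasDerivAt_const (z j) (z l)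
  have := (hF (fun s => Function.update z j s) _ (fun _ => t) 0 (z j) ht (fun l _ => hz l)
    (hasDerivAt_const _ _)).deriv
  rw [DelaySafe.pderivZ, this]
  simp

lemma HasPartials.pderivT {Fz Ft} (hF : HasPartials N F Fz Ft) (z : ℕ → ℝ) {t : ℝ}
    (ht : 0 < t) : pderivT F z t = Ft z t := by
  have := (hF (fun _ => z) 0 (fun s => s) 1 t ht (fun l _ => hasDerivAt_const _ _)
    (hasDerivAt_id _)).deriv
  rw [DelaySafe.pderivT, this]
  simp

namespace IsRegular

lemma isTame (hF : IsRegular h N r F) : IsTame h N F := by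
  cases r with
  | zero => exact hF
  | succ r => exact hF.1

lemma congr (hF : IsRegular h N r F) (hFG : ∀ z t, 0 < t → F z t = G z t) :
    IsRegular h N r G := by
  cases r with
  | zero => exact IsTame.congr hF hFG
  | succ r =>
    obtain ⟨h0, Fz, Ft, hp, hz, ht, hs⟩ := hF
    refine ⟨h0.congr hFG, Fz, Ft, fun z z' τ τ' s hτ hz' hτ' => ?_, hz, ht, hs⟩
    refine (hp z z' τ τ' s hτ hz' hτ').congr_of_eventuallyEq ?_
    filter_upwards [hτ'.continuousAt.eventually (lt_mem_nhds hτ)] with r hr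
    exact (hFG _ _ hr).symm

lemma mono (hF : IsRegular h N r F) {N' : ℕ} (hN : N ≤ N') : IsRegular h N' r F := by
  induction r generalizing F with
  | zero => exact IsTame.mono hF hN
  | succ r ih =>
    obtain ⟨h0, Fz, Ft, hp, hz, ht, hs⟩ := hF
    have hsub := Finset.Icc_subset_Icc_right (a := 1) hN
    refine ⟨h0.mono hN, Fz, Ft, fun z z' τ τ' s hτ hz' hτ' => ?_, fun j => ih (hz j), ih ht,
      fun j hj => hs j fun hj' => hj (hsub hj')⟩
    -- The additional coordinates contribute nothing to the chain rule, because the partial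
    -- derivatives vanish off `Icc 1 N`.
    rw [← Finset.sum_subset hsub fun j _ hj => by simp [hs j hj]]
    exact hp z z' τ τ' s hτ (fun j hj => hz' j (hsub hj)) hτ'

lemma of_succ (hF : IsRegular h N (r + 1) F) : IsRegular h N r F := by
  induction r generalizing F with
  | zero => exact hF.1
  | succ r ih =>
    obtain ⟨h0, Fz, Ft, hp, hz, ht, hs⟩ := hF
    exact ⟨h0, Fz, Ft, hp, fun j => ih (hz j), ih ht, hs⟩

lemma add (hF : IsRegular h N r F) (hG : IsRegular h N r G) :
    IsRegular h N r fun z t => F z t + G z t := by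
  induction r generalizing F G with
  | zero => exact IsTame.add hF hG
  | succ r ih =>
    obtain ⟨h0, Fz, Ft, hp, hz, ht, hs⟩ := hF
    obtain ⟨h0', Gz, Gt, hp', hz', ht', hs'⟩ := hG
    refine ⟨h0.add h0', fun j z t => Fz j z t + Gz j z t, fun z t => Ft z t + Gt z t,
      fun z z' τ τ' s hτ h1 h2 => ?_, fun j => ih (hz j) (hz' j), ih ht ht',
      fun j hj => by funext z t; simp [hs j hj, hs' j hj]⟩
    refine ((hp z z' τ τ' s hτ h1 h2).add (hp' z z' τ τ' s hτ h1 h2)).congr_deriv ?_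
    simp only [add_mul, Finset.sum_add_distrib]
    ring

lemma mul (hF : IsRegular h N r F) (hG : IsRegular h N r G) :
    IsRegular h N r fun z t => F z t * G z t := by
  induction r generalizing F G with
  | zero => exact IsTame.mul hF hG
  | succ r ih =>
    -- The Leibniz rule multiplies derivatives of order `r` by the undifferentiated factors, which
    -- must be lowered to the same order before the induction hypothesis applies.
    have hF' := hF.of_succ
    have hG' := hG.of_succ
    obtain ⟨h0, Fz, Ft, hp, hz, ht, hs⟩ := hF
    obtain ⟨h0', Gz, Gt, hp', hz', ht', hs'⟩ := hG
    refine ⟨h0.mul h0', fun j z t => Fz j z t * G z t + F z t * Gz j z t,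
      fun z t => Ft z t * G z t + F z t * Gt z t,
      fun z z' τ τ' s hτ h1 h2 => ?_, fun j => (ih (hz j) hG').add (ih hF' (hz' j)),
      (ih ht hG').add (ih hF' ht'), fun j hj => by funext z t; simp [hs j hj, hs' j hj]⟩
    refine ((hp z z' τ τ' s hτ h1 h2).mul (hp' z z' τ τ' s hτ h1 h2)).congr_deriv ?_
    simp only [add_mul, mul_add, Finset.sum_add_distrib, Finset.sum_mul, Finset.mul_sum]
    have e1 : ∀ j, Fz j (z s) (τ s) * G (z s) (τ s) * z' j
        = Fz j (z s) (τ s) * z' j * G (z s) (τ s) := fun j => by ring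
    have e2 : ∀ j, F (z s) (τ s) * Gz j (z s) (τ s) * z' j
        = F (z s) (τ s) * (Gz j (z s) (τ s) * z' j) := fun j => by ring
    simp only [e1, e2]
    ring

lemma const (c : ℝ) : IsRegular h N r fun _ _ => c := by
  induction r generalizing c with
  | zero => exact IsTame.const c
  | succ r ih =>
    refine ⟨IsTame.const c, 0, 0, fun z z' τ τ' s hτ h1 h2 => ?_, fun _ => ih 0, ih 0,
      fun _ _ => rfl⟩
    simpa using hasDerivAt_const s c

lemma coord {j : ℕ} (hj : j ∈ Finset.Icc 1 N) : IsRegular h N r fun z _ => z j := by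
  cases r with
  | zero => exact IsTame.coord hj
  | succ r =>
    refine ⟨IsTame.coord hj, fun l _ _ => if l = j then 1 else 0, 0,
      fun z z' τ τ' s hτ h1 h2 => ?_, fun l => const _, const 0, fun l hl => ?_⟩
    · refine (h1 j hj).congr_deriv ?_
      rw [Finset.sum_congr rfl fun l _ => ite_mul _ _ _ _]
      simp only [one_mul, zero_mul, Finset.sum_ite_eq', if_pos hj]
      simp
    · have : l ≠ j := fun h => hl (h ▸ hj)
      funext z t
      simp [this]

lemma sum {ι : Type*} (s : Finset ι) {f : ι → (ℕ → ℝ) → ℝ → ℝ}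
    (hf : ∀ i ∈ s, IsRegular h N r (f i)) : IsRegular h N r fun z t => ∑ i ∈ s, f i z t := by
  classical
  induction s using Finset.induction_on with
  | empty => simpa using const (0 : ℝ)
  | insert a s ha ih =>
    simp only [Finset.sum_insert ha]
    exact (hf a (Finset.mem_insert_self _ _)).add
      (ih fun i hi => hf i (Finset.mem_insert_of_mem hi))

/-- Functions of `z 1` and `t` with bounded derivatives. -/
lemma of_contDiffOn {g : ℝ → ℝ → ℝ} (hg : ContDiffOn ℝ r (Function.uncurry g) (univ ×ˢ Ioi 0))
    (hg0 : ∀ M : ℝ, ∃ c, ∀ e t, 0 < t → |h e t| ≤ M → |e| ≤ M → |g e t| ≤ c)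
    (hgd : ∀ M : ℝ, ∃ c, ∀ e t : ℝ, |e| ≤ M → 0 < t → ∀ i : ℕ, 1 ≤ i → i ≤ r →
      ‖iteratedFDeriv ℝ i (Function.uncurry g) (e, t)‖ ≤ c) :
    IsRegular h 1 r fun z t => g (z 1) t := by
  have hopen : IsOpen ((univ : Set ℝ) ×ˢ Ioi (0 : ℝ)) := isOpen_univ.prod isOpen_Ioi
  have hcont (g : ℝ → ℝ → ℝ) (hg : ContinuousOn (Function.uncurry g) (univ ×ˢ Ioi 0)) :
      ContinuousOn (Function.uncurry fun (z : ℕ → ℝ) t => g (z 1) t) (univ ×ˢ Ioi 0) :=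
    hg.comp (f := fun p : (ℕ → ℝ) × ℝ => (p.1 1, p.2)) (by fun_prop) fun p hp => ⟨mem_univ _, hp.2⟩
  have tame : ∀ (g : ℝ → ℝ → ℝ) (_ : ContinuousOn (Function.uncurry g) (univ ×ˢ Ioi 0))
      (_ : ∀ M : ℝ, ∃ c, ∀ e t, 0 < t → |h e t| ≤ M → |e| ≤ M → |g e t| ≤ c),
      IsTame h 1 fun z t => g (z 1) t := by
    intro g hg hb
    refine ⟨fun M => ?_, hcont g hg⟩
    obtain ⟨c, hc⟩ := hb M
    exact ⟨c, fun z t ht h1 h2 => hc _ _ ht h1 (h2 1 (by simp))⟩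
  induction r generalizing g with
  | zero => exact tame g hg.continuousOn hg0
  | succ r ih =>
    have hdiff : ∀ e t, 0 < t → DifferentiableAt ℝ (Function.uncurry g) (e, t) := fun e t ht =>
      (hg.differentiableOn (by simp)).differentiableAt (hopen.mem_nhds ⟨mem_univ _, ht⟩)
    have hfd : ContDiffOn ℝ r (fderiv ℝ (Function.uncurry g)) (univ ×ˢ Ioi 0) :=
      hg.fderiv_of_isOpen hopen (by norm_cast)
    -- A directional derivative of `g` is again a function of `z 1` and `t` to which the induction
    -- hypothesis applies. Its own size is controlled by the first-order bound on `g`, without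
    -- recourse to `|h| ≤ M`.
    have key : ∀ v : ℝ × ℝ, IsRegular h 1 r fun z t => fderiv ℝ (Function.uncurry g) (z 1, t) v := by
      intro v
      have hbd : ∀ M : ℝ, ∃ c, ∀ e t : ℝ, |e| ≤ M → 0 < t → ∀ i : ℕ, i ≤ r →
          ‖iteratedFDeriv ℝ i (fun p => fderiv ℝ (Function.uncurry g) p v) (e, t)‖ ≤ c := by
        intro M
        obtain ⟨c, hc⟩ := hgd M
        refine ⟨‖v‖ * c, fun e t he ht i hi => ?_⟩
        have hca : ContDiffAt ℝ r (fderiv ℝ (Function.uncurry g)) (e, t) :=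
          hfd.contDiffAt (hopen.mem_nhds ⟨mem_univ _, ht⟩)
        refine (norm_iteratedFDeriv_clm_apply_const hca (by exact_mod_cast hi)).trans ?_
        rw [norm_iteratedFDeriv_fderiv]
        exact mul_le_mul_of_nonneg_left (hc e t he ht _ (by omega) (by omega)) (norm_nonneg _)
      refine ih (g := fun e t => fderiv ℝ (Function.uncurry g) (e, t) v)
        (hfd.clm_apply contDiffOn_const) (fun M => ?_) fun M => ?_
      · obtain ⟨c, hc⟩ := hbd M
        refine ⟨c, fun e t ht _ he => ?_⟩
        simpa using hc e t he ht 0 (Nat.zero_le _)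
      · obtain ⟨c, hc⟩ := hbd M
        exact ⟨c, fun e t he ht i _ hi => hc e t he ht i hi⟩
    refine ⟨tame g hg.continuousOn hg0,
      fun j => if j = 1 then fun z t => fderiv ℝ (Function.uncurry g) (z 1, t) (1, 0) else 0,
      fun z t => fderiv ℝ (Function.uncurry g) (z 1, t) (0, 1),
      fun z z' τ τ' s hτ h1 h2 => ?_, fun j => ?_, key _, fun j hj => ?_⟩
    · have := (hdiff (z s 1) (τ s) hτ).hasFDerivAt.comp_hasDerivAt s
        ((h1 1 (by simp)).prodMk h2)
      refine this.congr_deriv ?_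
      have e : ((z' 1, τ') : ℝ × ℝ) = z' 1 • (1, 0) + τ' • (0, 1) := by simp
      rw [e, map_add, map_smul, map_smul]
      simp [mul_comm]
    · by_cases hj : j = 1
      · simpa [hj] using key (1, 0)
      · simp only [if_neg hj]
        exact const 0
    · have : j ≠ 1 := fun h => hj (by simp [h])
      simp [this]

/-- Smooth functions of `t` with support bounded above. -/
lemma of_contDiff {s : ℝ → ℝ} (hs : ContDiff ℝ r s) (hs0 : ∃ c, ∀ t, c < t → s t = 0) :
    IsRegular h N r fun _ t => s t := by
  have tame : ∀ s : ℝ → ℝ, Continuous s → (∃ c, ∀ t, c < t → s t = 0) →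
      IsTame h N fun _ t => s t := by
    intro s hs hs0
    obtain ⟨c, hc⟩ := exists_bound_of_continuous_of_eq_zero hs hs0
    exact ⟨fun _ => ⟨c, fun z t ht _ _ => hc t ht⟩, (hs.comp continuous_snd).continuousOn⟩
  induction r generalizing s with
  | zero => exact tame s hs.continuous hs0
  | succ r ih =>
    have hs' : ContDiff ℝ r (deriv s) := (contDiff_succ_iff_deriv.1 (by exact_mod_cast hs)).2.2
    refine ⟨tame s hs.continuous hs0, 0, fun _ t => deriv s t, fun z z' τ τ' x hτ h1 h2 => ?_,
      fun _ => const 0, ih hs' ?_, fun _ _ => rfl⟩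
    · have := ((hs.differentiable (by simp)) (τ x)).hasDerivAt.comp x h2
      exact this.congr_deriv (by simp)
    · obtain ⟨c, hc⟩ := hs0
      refine ⟨c, fun t ht => ?_⟩
      have : s =ᶠ[𝓝 t] fun _ => 0 := by
        filter_upwards [lt_mem_nhds ht] with x hx using hc x hx
      rw [this.deriv_eq, deriv_const]

lemma pderivZ (hF : IsRegular h N (r + 1) F) (j : ℕ) : IsRegular h N r (pderivZ F j) := by
  obtain ⟨h0, Fz, Ft, hp, hz, ht, hs⟩ := hF
  refine (hz j).congr fun z t ht => ?_
  rw [hp.pderivZ j z ht]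
  split_ifs with hj
  · rfl
  · simp [hs j hj]

lemma pderivT (hF : IsRegular h N (r + 1) F) : IsRegular h N r (pderivT F) := by
  obtain ⟨h0, Fz, Ft, hp, hz, ht, hs⟩ := hF
  exact ht.congr fun z t ht => (hp.pderivT z ht).symm

lemma hasPartials (hF : IsRegular h N (r + 1) F) :
    HasPartials N F (DelaySafe.pderivZ F) (DelaySafe.pderivT F) := by
  obtain ⟨h0, Fz, Ft, hp, hz, ht, hs⟩ := hF
  intro z z' τ τ' s hτ h1 h2
  rw [hp.pderivT _ hτ, Finset.sum_congr rfl fun j hj => by rw [hp.pderivZ j _ hτ, if_pos hj]]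
  exact hp z z' τ τ' s hτ h1 h2

end IsRegular

end DelaySafe

/-! ### Smoothness of the recovery function. -/

namespace DelaySafe

section Recovery

open Polynomial in
-- The polynomial factor makes the family stable under differentiation: `p` is replaced by `2 X³ p -
-- X² p'`. Smoothness then follows by induction once every member is known to be flat at `0`.
lemma contDiff_inv_poly_mul_exp_neg_inv_sq {m : ℕ} (p : ℝ[X]) : ContDiff ℝ m
    fun x : ℝ => if 0 < x then p.eval x⁻¹ * Real.exp (-(x⁻¹ ^ 2)) else 0 := by
  have hlim : ∀ p : ℝ[X], Tendsto
      (fun x : ℝ => if 0 < x then p.eval x⁻¹ * Real.exp (-(x⁻¹ ^ 2)) else 0) (𝓝 0) (𝓝 0) := by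
    intro p
    refine squeeze_zero_norm' ?_ (by simpa using (expNegInvGlue.tendsto_polynomial_inv_mul_zero p).norm)
    filter_upwards [gt_mem_nhds zero_lt_one] with x hx
    split_ifs with h0
    · simp only [norm_mul, Real.norm_eq_abs]
      refine mul_le_mul_of_nonneg_left ?_ (abs_nonneg _)
      -- For `0 < x < 1` one has `x⁻² ≥ x⁻¹`, so the function is dominated by the one built from
      -- `exp (-1/x)`.
      have h1 : 1 ≤ x⁻¹ := (one_le_inv₀ h0).2 hx.le
      simp only [expNegInvGlue, not_le.2 h0, if_false, Real.abs_exp]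
      gcongr
      nlinarith
    · simp only [norm_zero]
      positivity
  have hder : ∀ (p : ℝ[X]) (x : ℝ), HasDerivAt
      (fun x : ℝ => if 0 < x then p.eval x⁻¹ * Real.exp (-(x⁻¹ ^ 2)) else 0)
      (if 0 < x then (2 * X ^ 3 * p - X ^ 2 * derivative p).eval x⁻¹ * Real.exp (-(x⁻¹ ^ 2)) else 0)
      x := by
    intro p x
    rcases lt_trichotomy x 0 with hx | rfl | hx
    · rw [if_neg hx.le.not_gt]
      refine (hasDerivAt_const x (0 : ℝ)).congr_of_eventuallyEq ?_
      filter_upwards [gt_mem_nhds hx] with y hy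
      rw [if_neg (lt_asymm hy)]
    · rw [if_neg (lt_irrefl _), hasDerivAt_iff_tendsto_slope]
      -- The difference quotient at `0` belongs to the same family, with `p * X` in place of `p`.
      refine ((hlim (p * X)).mono_left inf_le_left).congr fun x => ?_
      rw [slope_def_field, if_neg (lt_irrefl (0 : ℝ))]
      split_ifs <;> simp [div_eq_mul_inv, mul_right_comm]
    · rw [if_pos hx]
      have h1 : HasDerivAt (fun x : ℝ => p.eval x⁻¹)
          ((derivative p).eval x⁻¹ * (-(x ^ 2)⁻¹)) x :=
        (p.hasDerivAt x⁻¹).comp x (hasDerivAt_inv hx.ne')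
      have h2 : HasDerivAt (fun x : ℝ => Real.exp (-(x⁻¹ ^ 2)))
          (Real.exp (-(x⁻¹ ^ 2)) * (-(2 * x⁻¹ ^ (2 - 1) * (-(x ^ 2)⁻¹)))) x := by
        exact_mod_cast ((hasDerivAt_inv hx.ne').pow 2).neg.exp
      refine ((h1.mul h2).congr_of_eventuallyEq ?_).congr_deriv ?_
      · filter_upwards [lt_mem_nhds hx] with y hy
        simp [hy]
      · simp
        field_simp
        ring
  induction m generalizing p with
  | zero => exact contDiff_zero.2 (continuous_iff_continuousAt.2 fun x => (hder p x).continuousAt)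
  | succ m ih =>
    rw [Nat.cast_succ, contDiff_succ_iff_deriv]
    refine ⟨fun x => (hder p x).differentiableAt, by simp, ?_⟩
    rw [show deriv _ = _ from funext fun x => (hder p x).deriv]
    exact ih _

lemma contDiff_recovery (D h₀ ε tbar : ℝ) (m : ℕ) : ContDiff ℝ m (recovery D h₀ ε tbar) := by
  by_cases hh : h₀ ≤ 0
  · have := ((contDiff_inv_poly_mul_exp_neg_inv_sq (m := m) 1).comp
      (contDiff_const.sub contDiff_id : ContDiff ℝ m fun t : ℝ => (D + tbar) - t)).const_smul
      ((-h₀ + ε) * Real.exp (1 / tbar ^ 2))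
    convert this using 1
    funext t
    simp only [recovery, if_pos hh, Function.comp, sub_pos, Polynomial.eval_one, one_mul,
      smul_eq_mul, mul_ite, mul_zero]
    split_ifs with ht
    · rw [mul_assoc, ← Real.exp_add]
      congr 2
      rw [inv_pow, show (D + tbar - t) ^ 2 = (t - D - tbar) ^ 2 by ring]
      ring
    · rfl
  · have : recovery D h₀ ε tbar = fun _ => 0 := by
      funext t
      simp [recovery, hh]
    rw [this]
    exact contDiff_const

lemma recovery_eq_zero {D h₀ ε tbar t : ℝ} (ht : D + tbar ≤ t) : recovery D h₀ ε tbar t = 0 := by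
  simp [recovery, not_lt.2 ht]

end Recovery

/-! ### Structure and regularity of the functions `h_i`. -/

section Cbf

variable {h : ℝ → ℝ → ℝ} {s : ℝ → ℝ} {n : ℕ}

/-- The part of `cbf h s k (i + 1)` which does not contain `z (i + 1)`. -/
noncomputable def cbfRest (h : ℝ → ℝ → ℝ) (s : ℝ → ℝ) (k : ℕ → ℝ) (i : ℕ) (z : ℕ → ℝ) (t : ℝ) : ℝ :=
  (∑ j ∈ Finset.Icc 1 (i - 1), pderivZ (cbf h s k i) j z t * z (j + 1))
    + pderivT (cbf h s k i) z t + k i * cbf h s k i z t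

lemma cbf_succ_eq (k : ℕ → ℝ) (i : ℕ) (z : ℕ → ℝ) (t : ℝ) :
    cbf h s k (i + 2) z t = cbfRest h s k (i + 1) z t
      + pderivZ (cbf h s k (i + 1)) (i + 1) z t * z (i + 2) := by
  simp only [cbf, cbfRest, Nat.add_sub_cancel]
  rw [Finset.sum_Icc_succ_top (by omega)]
  ring

lemma IsRegular.cbfRest {k : ℕ → ℝ} {i r : ℕ} (hi : IsRegular h i (r + 1) (cbf h s k i)) :
    IsRegular h i r (cbfRest h s k i) := by
  refine ((IsRegular.sum _ fun j hj => (hi.pderivZ j).mul (.coord ?_)).add hi.pderivT).add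
    ((IsRegular.const _).mul hi.of_succ)
  simp only [Finset.mem_Icc] at hj ⊢
  omega

/-- Each step of the recursion adds one coordinate and uses up one derivative. At `i = n - 1`
exactly one order is left, which is what `f` needs. -/
lemma isRegular_cbf (hh : IsBarrier n h) (hs : ∀ m : ℕ, ContDiff ℝ m s)
    (hs0 : ∃ c, ∀ t, c < t → s t = 0) (k : ℕ → ℝ) (i : ℕ) (hi : i < n) :
    IsRegular h (i + 1) (n - i) (cbf h s k (i + 1)) := by
  induction i with
  | zero =>
    refine IsRegular.add (IsRegular.of_contDiffOn (g := h) ?_ ?_ hh.deriv_bdd)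
      (IsRegular.of_contDiff (hs _) hs0)
    · exact hh.smooth.mono (prod_mono_right Ioi_subset_Ici_self)
    · exact fun M => ⟨M, fun _ _ _ h _ => h⟩
  | succ i ih =>
    have h1 := ih (by omega)
    obtain ⟨r, hr⟩ : ∃ r, n - i = r + 1 := ⟨n - i - 1, by omega⟩
    have hr' : n - (i + 1) = r := by omega
    rw [hr] at h1
    rw [hr']
    have := (h1.cbfRest.mono (Nat.le_succ _)).add (((h1.pderivZ (i + 1)).mono (Nat.le_succ _)).mul
      (.coord (j := i + 2) (by simp)))
    exact this.congr fun z t _ => (cbf_succ_eq k i z t).symm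

/-- By `cbf_succ_eq` the newest coordinate enters linearly; its coefficient is the previous instance
of this identity, and `ϑ` depends on `z 1` and `t` only. So the leading coefficient is inherited
unchanged. -/
lemma pderivZ_cbf (hh : IsBarrier n h) (hs : ∀ m : ℕ, ContDiff ℝ m s)
    (hs0 : ∃ c, ∀ t, c < t → s t = 0) (k : ℕ → ℝ) (i : ℕ) (hi : i < n) (z : ℕ → ℝ) {t : ℝ}
    (ht : 0 < t) : pderivZ (cbf h s k (i + 1)) (i + 1) z t = vartheta h (z 1) t := by
  induction i generalizing z with
  | zero => simp [pderivZ, cbf, vartheta]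
  | succ i ih =>
    have h1 := isRegular_cbf hh hs hs0 k i (by omega)
    obtain ⟨r, hr⟩ : ∃ r, n - i = r + 1 + 1 := ⟨n - i - 2, by omega⟩
    rw [hr] at h1
    have hrest := h1.cbfRest
    have e : (fun x => cbf h s k (i + 2) (Function.update z (i + 2) x) t) = fun x =>
        cbfRest h s k (i + 1) (Function.update z (i + 2) x) t + vartheta h (z 1) t * x := by
      funext x
      rw [cbf_succ_eq, ih (by omega)]
      simp [Function.update_of_ne]
    have hd : HasDerivAt (fun x => cbfRest h s k (i + 1) (Function.update z (i + 2) x) t) 0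
        (z (i + 2)) := by
      have := hrest.hasPartials (fun x => Function.update z (i + 2) x) 0 (fun _ => t) 0 (z (i + 2))
        ht (fun j hj => ?_) (hasDerivAt_const _ _)
      · exact this.congr_deriv (by simp)
      · have : j ≠ i + 2 := by
          simp only [Finset.mem_Icc] at hj
          omega
        simpa [Function.update_of_ne this] using hasDerivAt_const (z (i + 2)) (z j)
    rw [pderivZ, e]
    exact ((hd.add ((hasDerivAt_id' (z (i + 2))).const_mul _)).congr_deriv (by simp)).deriv

end Cbf

end DelaySafe

/-! ### Matrix exponentials and linear systems. -/

namespace DelaySafe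

section LinearSystems

variable {ι κ : Type*} [Fintype κ]

lemma hasDerivAt_mulVec {E : ℝ → Matrix ι κ ℝ} {E' : Matrix ι κ ℝ} {w : ℝ → κ → ℝ} {w' : κ → ℝ}
    {t : ℝ} (hE : ∀ i j, HasDerivAt (fun s => E s i j) (E' i j) t) (hw : HasDerivAt w w' t) :
    HasDerivAt (fun s => E s *ᵥ w s) (E' *ᵥ w t + E t *ᵥ w') t := by
  rw [hasDerivAt_pi] at hw ⊢
  intro i
  have := HasDerivAt.fun_sum (u := Finset.univ) fun j _ => (hE i j).mul (hw j)
  refine this.congr_deriv ?_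
  simp [mulVec, dotProduct, Finset.sum_add_distrib]

variable [Fintype ι]

lemma intervalIntegrable_mulVec {E : ℝ → Matrix ι κ ℝ} {w : ℝ → κ → ℝ} {a b : ℝ}
    (hE : Continuous E) (hw : IntervalIntegrable w volume a b) :
    IntervalIntegrable (fun s => E s *ᵥ w s) volume a b := by
  have e : (fun s => E s *ᵥ w s) = fun s => ∑ j, w s j • fun i => E s i j := by
    funext s i
    simp [mulVec, dotProduct, mul_comm]
  rw [e]
  have hp : ∀ j, IntervalIntegrable (fun s => w s j) volume a b := fun j =>
    ⟨(ContinuousLinearMap.proj (R := ℝ) (φ := fun _ : κ => ℝ) j).integrable_comp hw.1,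
      (ContinuousLinearMap.proj (R := ℝ) (φ := fun _ : κ => ℝ) j).integrable_comp hw.2⟩
  have := IntervalIntegrable.sum (μ := volume) (a := a) (b := b) Finset.univ
    (f := fun j s => w s j • fun i => E s i j) fun j _ =>
      (hp j).smul_continuousOn (Continuous.continuousOn (by fun_prop))
  simpa only [Finset.sum_fn] using! this

lemma intervalIntegral_mulVec (E : Matrix ι κ ℝ) {w : ℝ → κ → ℝ} {a b : ℝ}
    (hw : IntervalIntegrable w volume a b) :
    ∫ s in a..b, E *ᵥ w s = E *ᵥ ∫ s in a..b, w s :=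
  (E.mulVecLin.toContinuousLinearMap).intervalIntegral_comp_comm hw

lemma intervalIntegral_dotProduct (c : κ → ℝ) {w : ℝ → κ → ℝ} {a b : ℝ}
    (hw : IntervalIntegrable w volume a b) :
    ∫ s in a..b, c ⬝ᵥ w s = c ⬝ᵥ ∫ s in a..b, w s := by
  have := congrFun (intervalIntegral_mulVec (Matrix.of fun _ : Unit => c) hw) ()
  have h2 := (ContinuousLinearMap.proj (R := ℝ) (φ := fun _ : Unit => ℝ) ()).intervalIntegral_comp_comm
    (intervalIntegrable_mulVec (continuous_const (y := Matrix.of fun _ : Unit => c)) hw)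
  exact h2.trans this

variable [DecidableEq ι] (M : Matrix ι ι ℝ)

/-- Stated for entries, so that the matrix norm needed to differentiate the exponential stays inside
the proof. -/
lemma hasDerivAt_exp_entry (t : ℝ) (i j : ι) :
    HasDerivAt (fun s : ℝ => NormedSpace.exp (s • M) i j) ((NormedSpace.exp (t • M) * M) i j) t := by
  open scoped Norms.Operator in
  have h := hasDerivAt_exp_smul_const (𝕂 := ℝ) M t
  have := hasDerivAt_pi.1 (hasDerivAt_pi.1 h i) j
  exact this

lemma commute_exp_smul (t : ℝ) : Commute M (NormedSpace.exp (t • M)) := by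
  open scoped Norms.Operator in
  exact ((Commute.refl M).smul_right t).exp_right

lemma continuous_exp_smul : Continuous fun s : ℝ => NormedSpace.exp (s • M) :=
  continuous_pi fun i => continuous_pi fun j => continuous_iff_continuousAt.2 fun t =>
    (hasDerivAt_exp_entry M t i j).continuousAt

lemma exp_add_smul (s t : ℝ) :
    NormedSpace.exp ((s + t) • M) = NormedSpace.exp (s • M) * NormedSpace.exp (t • M) := by
  rw [add_smul]
  exact Matrix.exp_add_of_commute _ _ (((Commute.refl M).smul_right t).smul_left s)

lemma exp_smul_mul_exp_neg_smul (s : ℝ) :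
    NormedSpace.exp (s • M) * NormedSpace.exp ((-s) • M) = 1 := by
  rw [← exp_add_smul]
  simp

lemma hasDerivAt_exp_mulVec {w : ℝ → ι → ℝ} {w' : ι → ℝ} {t : ℝ} (hw : HasDerivAt w w' t) :
    HasDerivAt (fun s => NormedSpace.exp (s • M) *ᵥ w s)
      (M *ᵥ (NormedSpace.exp (t • M) *ᵥ w t) + NormedSpace.exp (t • M) *ᵥ w') t := by
  refine (hasDerivAt_mulVec (hasDerivAt_exp_entry M t) hw).congr_deriv ?_
  rw [mulVec_mulVec, (commute_exp_smul M t).eq]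

/-- The variation of constants formula. -/
lemma eq_exp_mulVec_add_integral {x g : ℝ → ι → ℝ} {t : ℝ} (ht : 0 ≤ t) {Q : Set ℝ}
    (hQ : Q.Countable) (hx : ContinuousOn x (Icc 0 t))
    (hd : ∀ s ∈ Ioo 0 t \ Q, HasDerivAt x (M *ᵥ x s + g s) s)
    (hg : IntervalIntegrable g volume 0 t) :
    x t = NormedSpace.exp (t • M) *ᵥ
      (x 0 + ∫ s in (0 : ℝ)..t, NormedSpace.exp ((-s) • M) *ᵥ g s) := by
  have hc : Continuous fun s : ℝ => NormedSpace.exp ((-s) • M) :=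
    (continuous_exp_smul M).comp continuous_neg
  -- The function `e^{-sM} x(s)` has derivative `e^{-sM} g(s)` off `Q`.
  have key := integral_eq_of_hasDerivAt_off_countable_of_le
    (fun s => NormedSpace.exp ((-s) • M) *ᵥ x s) (fun s => NormedSpace.exp ((-s) • M) *ᵥ g s) ht hQ
    ?_ (fun s hs => ?_) (intervalIntegrable_mulVec hc hg)
  · rw [key]
    simp only [neg_zero, zero_smul, NormedSpace.exp_zero, one_mulVec, add_sub_cancel]
    rw [mulVec_mulVec, exp_smul_mul_exp_neg_smul, one_mulVec]
  · refine continuousOn_pi.2 fun i => ?_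
    simp only [mulVec, dotProduct]
    refine continuousOn_finsetSum _ fun j _ => ContinuousOn.mul ?_ (continuousOn_pi.1 hx j)
    exact (continuous_apply_apply i j |>.comp hc).continuousOn
  · have h1 : ∀ i j, HasDerivAt (fun s : ℝ => NormedSpace.exp ((-s) • M) i j)
        ((-(NormedSpace.exp ((-s) • M) * M)) i j) s := fun i j =>
      ((hasDerivAt_exp_entry M (-s) i j).comp s (hasDerivAt_neg s)).congr_deriv (by simp)
    refine (hasDerivAt_mulVec h1 (hd s hs)).congr_deriv ?_
    simp [mulVec_add, mulVec_mulVec, neg_mulVec]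

/-- A matrix which is diagonalizable over `ℂ` and has only imaginary eigenvalues generates a
bounded flow. -/
lemma exists_bound_exp_mulVec (hre : ∀ μ ∈ spectrum ℂ (M.map (algebraMap ℝ ℂ)), μ.re = 0)
    (hss : Module.End.IsSemisimple (Matrix.toLin' (M.map (algebraMap ℝ ℂ)))) (v : ι → ℝ) :
    ∃ C, ∀ t : ℝ, ‖NormedSpace.exp (t • M) *ᵥ v‖ ≤ C := by
  set Mc := M.map (algebraMap ℝ ℂ) with hMc
  let E : ℝ → Matrix ι ι ℂ := fun t => (NormedSpace.exp (t • M)).map (algebraMap ℝ ℂ)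
  have key : ∀ w : ι → ℂ, ∃ C, ∀ t : ℝ, ‖E t *ᵥ w‖ ≤ C := by
    intro w
    -- Semisimplicity makes the eigenvectors span, and boundedness of an orbit passes to sums; so
    -- one eigenvector at a time suffices.
    have hw : w ∈ ⨆ μ : ℂ, Module.End.eigenspace (Matrix.toLin' Mc) μ := by
      rw [hss.iSup_eigenspace_eq_top]
      trivial
    induction hw using Submodule.iSup_induction' with
    | mem μ w hw =>
      by_cases hw0 : w = 0
      · exact ⟨0, fun t => by simp [hw0]⟩
      have hμ : μ.re = 0 := by
        refine hre μ ?_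
        rw [← Matrix.spectrum_toLin']
        exact (Module.End.hasEigenvalue_of_hasEigenvector ⟨hw, hw0⟩).mem_spectrum
      have hw' : Mc *ᵥ w = μ • w := by
        simpa using Module.End.mem_eigenspace_iff.1 hw
      have hd : ∀ (i : ι) (t : ℝ), HasDerivAt (fun t : ℝ => (E t *ᵥ w) i) (μ * (E t *ᵥ w) i) t := by
        intro i t
        have h1 : ∀ j, HasDerivAt (fun t : ℝ => E t i j * w j)
            ((((NormedSpace.exp (t • M) * M) i j : ℝ) : ℂ) * w j) t := fun j =>
          ((hasDerivAt_exp_entry M t i j).ofReal_comp).mul_const (w j)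
        have h2 := HasDerivAt.fun_sum (u := Finset.univ) fun j _ => h1 j
        refine h2.congr_deriv ?_
        have h3 : ∑ j, (((NormedSpace.exp (t • M) * M) i j : ℝ) : ℂ) * w j
            = (((NormedSpace.exp (t • M) * M).map (algebraMap ℝ ℂ)) *ᵥ w) i := rfl
        rw [h3, Matrix.map_mul, ← mulVec_mulVec, hw', mulVec_smul]
        rfl
      refine ⟨‖w‖, fun t => (pi_norm_le_iff_of_nonneg (norm_nonneg _)).2 fun i => ?_⟩
      -- On an eigenvector `e^{-μt} E(t) w` is constant, and `|e^{-μt}| = 1` because `μ` is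
      -- imaginary.
      have hc : ∀ t : ℝ, HasDerivAt (fun t : ℝ => Complex.exp (-μ * t) * (E t *ᵥ w) i) 0 t := by
        intro t
        have h1 : HasDerivAt (fun t : ℝ => Complex.exp (-μ * t))
            (Complex.exp (-μ * t) * (-μ)) t := by
          have := ((Complex.ofRealCLM.hasDerivAt (x := t)).const_mul (-μ)).cexp
          exact this.congr_deriv (by simp)
        refine (h1.mul (hd i t)).congr_deriv ?_
        ring
      have h0 := is_const_of_deriv_eq_zero (fun t => (hc t).differentiableAt)
        (fun t => (hc t).deriv) t 0
      have hE0 : E 0 *ᵥ w = w := by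
        simp [E]
      have h1 : ‖Complex.exp (-μ * t) * (E t *ᵥ w) i‖ = ‖w i‖ := by
        rw [h0, hE0]
        simp
      rw [norm_mul, Complex.norm_exp] at h1
      simp only [neg_mul, Complex.neg_re, Complex.mul_re, hμ, Complex.ofReal_im, zero_mul, mul_zero,
        sub_zero, neg_zero, Real.exp_zero, one_mul] at h1
      rw [h1]
      exact norm_le_pi_norm w i
    | zero => exact ⟨0, fun t => by simp⟩
    | add x y _ _ hx hy =>
      obtain ⟨c, hc⟩ := hx
      obtain ⟨d, hd⟩ := hy
      refine ⟨c + d, fun t => ?_⟩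
      rw [mulVec_add]
      exact (norm_add_le _ _).trans (add_le_add (hc t) (hd t))
  obtain ⟨C, hC⟩ := key fun i => (v i : ℂ)
  have hC0 : 0 ≤ C := (norm_nonneg _).trans (hC 0)
  refine ⟨C, fun t => (pi_norm_le_iff_of_nonneg hC0).2 fun i => ?_⟩
  have e : (E t *ᵥ fun i => (v i : ℂ)) i = (((NormedSpace.exp (t • M) *ᵥ v) i : ℝ) : ℂ) := by
    simp [E, mulVec, dotProduct]
  rw [← Complex.norm_real, ← e]
  exact (norm_le_pi_norm _ i).trans (hC t)

end LinearSystems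

end DelaySafe

/-! ### The response of the plant and the predictor. -/

namespace DelaySafe

namespace Plant

variable {n m nd nr : ℕ} (P : Plant n m nd nr)

lemma continuous_expA : Continuous P.expA := continuous_exp_smul P.A

lemma continuous_expS : Continuous P.expS := continuous_exp_smul P.S

lemma expA_add (s t : ℝ) : P.expA (s + t) = P.expA s * P.expA t := exp_add_smul P.A s t

lemma expS_add (s t : ℝ) : P.expS (s + t) = P.expS s * P.expS t := exp_add_smul P.S s t

lemma expA_zero : P.expA 0 = 1 := by simp [expA]

lemma hasDerivAt_expS_mulVec (v : Fin nd ⊕ Fin nr → ℝ) (t : ℝ) :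
    HasDerivAt (fun s => P.expS s *ᵥ v) (P.S *ᵥ (P.expS t *ᵥ v)) t :=
  (hasDerivAt_exp_mulVec P.S (hasDerivAt_const t v)).congr_deriv (by simp; rfl)

/-- The inhomogeneity of the plant equation. -/
noncomputable def forcing (U : ℝ → ℝ) (v₀ : Fin nd ⊕ Fin nr → ℝ) (s : ℝ) : Fin n → ℝ :=
  P.actuator U 0 s • P.B + P.GBar *ᵥ (P.expS s *ᵥ v₀)

/-- The state of the plant at time `s` in response to the input signal `U` and the initial data. -/
noncomputable def response (U : ℝ → ℝ) (x₀ : Fin n → ℝ) (v₀ : Fin nd ⊕ Fin nr → ℝ) (s : ℝ) :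
    Fin n → ℝ :=
  P.expA s *ᵥ (x₀ + ∫ σ in (0 : ℝ)..s, P.expA (-σ) *ᵥ P.forcing U v₀ σ)

variable {P} {U : ℝ → ℝ} {x₀ : Fin n → ℝ} {v₀ : Fin nd ⊕ Fin nr → ℝ} {t : ℝ}

lemma actuator_eq_shift (x t : ℝ) :
    P.actuator U x t = P.actuator U 0 (t + P.D * x) := by
  unfold actuator
  rw [show t + P.D * x - P.D + P.D * 0 = t - P.D + P.D * x by ring]

lemma actuator_zero_add {t : ℝ} (ht : 0 < t) : P.actuator U 0 (t + P.D) = U t := by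
  simp [actuator, ht]

lemma intervalIntegrable_actuator (hD : 0 < P.D) (ht : 0 ≤ t)
    (hU : IntervalIntegrable U volume 0 t) :
    IntervalIntegrable (P.actuator U 0) volume 0 (t + P.D) := by
  have h1 : IntervalIntegrable (P.actuator U 0) volume 0 P.D := by
    refine (intervalIntegrable_const (c := (0 : ℝ))).congr fun s hs => ?_
    rw [uIoc_of_le hD.le] at hs
    simp only [actuator, mul_zero, add_zero, sub_pos]
    rw [if_neg (not_lt.2 hs.2)]
  have h2 : IntervalIntegrable (P.actuator U 0) volume P.D (t + P.D) := by
    have := hU.comp_sub_right P.D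
    rw [zero_add] at this
    refine this.congr fun s hs => ?_
    rw [uIoc_of_le (by linarith)] at hs
    simp only [actuator, mul_zero, add_zero, sub_pos]
    rw [if_pos hs.1]
  exact h1.trans h2

lemma intervalIntegrable_forcing (hD : 0 < P.D) (ht : 0 ≤ t)
    (hU : IntervalIntegrable U volume 0 t) :
    IntervalIntegrable (P.forcing U v₀) volume 0 (t + P.D) := by
  refine ((intervalIntegrable_actuator hD ht hU).smul_continuousOn continuousOn_const).add
    (Continuous.intervalIntegrable ?_ _ _)
  exact continuous_const.matrix_mulVec (P.continuous_expS.matrix_mulVec continuous_const)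

lemma intervalIntegrable_response (hD : 0 < P.D) (ht : 0 ≤ t)
    (hU : IntervalIntegrable U volume 0 t) :
    IntervalIntegrable (fun σ => P.expA (-σ) *ᵥ P.forcing U v₀ σ) volume 0 (t + P.D) :=
  intervalIntegrable_mulVec (P.continuous_expA.comp continuous_neg)
    (intervalIntegrable_forcing hD ht hU)

lemma continuousOn_response (hD : 0 < P.D) (ht : 0 ≤ t) (hU : IntervalIntegrable U volume 0 t) :
    ContinuousOn (P.response U x₀ v₀) (Icc 0 (t + P.D)) := by
  have h1 := intervalIntegral.continuousOn_primitive_interval'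
    (intervalIntegrable_response (v₀ := v₀) hD ht hU) left_mem_uIcc
  rw [uIcc_of_le (by linarith)] at h1
  refine continuousOn_pi.2 fun i => ?_
  simp only [response, mulVec, dotProduct]
  refine continuousOn_finsetSum _ fun j _ => ContinuousOn.mul ?_ ?_
  · exact ((continuous_apply_apply i j).comp P.continuous_expA).continuousOn
  · exact continuousOn_const.add (continuousOn_pi.1 h1 j)

lemma intervalIntegrable_actuator_state (hD : 0 < P.D) (ht : 0 ≤ t)
    (hU : IntervalIntegrable U volume 0 t) :
    IntervalIntegrable (fun y => P.actuator U y t) volume 0 1 := by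
  have hact := (intervalIntegrable_actuator hD ht hU).mono_set (c := t) (d := t + P.D) (by
    rw [uIcc_of_le (by linarith), uIcc_of_le (by linarith)]; exact Icc_subset_Icc_left ht)
  have h1 := (hact.comp_add_left t).comp_mul_left (c := P.D)
  simp only [sub_self, zero_div, add_sub_cancel_left, div_self hD.ne'] at h1
  exact h1.congr fun y _ => (actuator_eq_shift y t).symm

lemma intervalIntegrable_input_term {u : ℝ → ℝ} (hu : IntervalIntegrable u volume 0 1) :
    IntervalIntegrable (fun y => (P.D * u y) • (P.expA (P.D * (1 - y)) *ᵥ P.B)) volume 0 1 := by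
  refine (hu.const_mul P.D).smul_continuousOn (Continuous.continuousOn ?_)
  exact (P.continuous_expA.comp (by fun_prop)).matrix_mulVec continuous_const

lemma continuous_exo_term (v : Fin nd ⊕ Fin nr → ℝ) : Continuous fun y =>
    P.D • (P.expA (P.D * (1 - y)) *ᵥ (P.GBar *ᵥ (P.expS (P.D * y) *ᵥ v))) := by
  have h1 : Continuous fun y => P.expA (P.D * (1 - y)) := P.continuous_expA.comp (by fun_prop)
  have h2 : Continuous fun y => P.expS (P.D * y) := P.continuous_expS.comp (by fun_prop)
  exact (h1.matrix_mulVec (continuous_const.matrix_mulVec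
    (h2.matrix_mulVec continuous_const))).const_smul P.D

/-- The predictor yields the response `D` time units ahead. -/
lemma predX_response (hD : 0 < P.D) (ht : 0 ≤ t) (hU : IntervalIntegrable U volume 0 t) :
    P.predX (P.response U x₀ v₀ t) (P.expS t *ᵥ v₀) (fun y => P.actuator U y t) P.D
      = P.response U x₀ v₀ (t + P.D) := by
  have hint := intervalIntegrable_response (v₀ := v₀) hD ht hU
  have hint1 := hint.mono_set (c := 0) (d := t) (by
    rw [uIcc_of_le ht, uIcc_of_le (by linarith)]; exact Icc_subset_Icc_right (by linarith))
  have hint2 := hint.mono_set (c := t) (d := t + P.D) (by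
    rw [uIcc_of_le (by linarith), uIcc_of_le (by linarith)]; exact Icc_subset_Icc_left ht)
  have hmv : ∫ σ in t..t + P.D, P.expA (t + P.D) *ᵥ (P.expA (-σ) *ᵥ P.forcing U v₀ σ)
      = P.expA (t + P.D) *ᵥ ∫ σ in t..t + P.D, P.expA (-σ) *ᵥ P.forcing U v₀ σ :=
    intervalIntegral_mulVec _ hint2
  -- The substitution `σ = t + D y` turns the integral over `[t, t + D]` into the predictor integral
  -- over `[0, 1]`.
  have hsub := intervalIntegral.smul_integral_comp_add_mul (a := 0) (b := 1)
    (fun σ => P.expA (t + P.D) *ᵥ (P.expA (-σ) *ᵥ P.forcing U v₀ σ)) P.D t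
  rw [mul_zero, add_zero, mul_one, hmv, ← intervalIntegral.integral_smul] at hsub
  rw [predX, div_self hD.ne', add_assoc, ← intervalIntegral.integral_add
    (intervalIntegrable_input_term (intervalIntegrable_actuator_state hD ht hU))
    ((continuous_exo_term _).intervalIntegrable _ _), response, response,
    ← intervalIntegral.integral_add_adjacent_intervals hint1 hint2,
    ← add_assoc, mulVec_add (P.expA (t + P.D)), ← hsub, mulVec_mulVec,
    ← expA_add, add_comm P.D t]
  congr 1
  refine intervalIntegral.integral_congr fun y _ => ?_
  simp only [forcing]
  rw [mulVec_mulVec _ (P.expA (t + P.D)), ← expA_add, mul_smul, ← smul_add, actuator_eq_shift y t, mulVec_add,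
    mulVec_smul, mulVec_mulVec _ (P.expS (P.D * y)), ← expS_add,
    show t + P.D + -(t + P.D * y) = P.D * (1 - y) by ring, add_comm (P.D * y) t]

/-- The controller as a static feedback of the predicted states. -/
lemma control_eq (hD : 0 < P.D) (h : ℝ → ℝ → ℝ) (s : ℝ → ℝ) (k : ℕ → ℝ) (x : Fin n → ℝ)
    (v : Fin nd ⊕ Fin nr → ℝ) {u : ℝ → ℝ} (hu : IntervalIntegrable u volume 0 1) (t : ℝ) :
    P.control h s k x v u t = -(P.K ⬝ᵥ P.predX x v u P.D) - P.G0 ⬝ᵥ (P.expS P.D *ᵥ v)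
      - driftTerm n P.b h s k (P.predZ x v u P.D) (t + P.D)
        / vartheta h (P.predZ x v u P.D 1) (t + P.D) := by
  have h1 : ∫ y in (0 : ℝ)..1, P.D * (P.K ⬝ᵥ (P.expA (P.D * (1 - y)) *ᵥ P.B)) * u y
      = P.K ⬝ᵥ ∫ y in (0 : ℝ)..1, (P.D * u y) • (P.expA (P.D * (1 - y)) *ᵥ P.B) := by
    rw [← intervalIntegral_dotProduct _ (intervalIntegrable_input_term hu)]
    refine intervalIntegral.integral_congr fun y _ => ?_
    simp only [dotProduct_smul, smul_eq_mul]
    ring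
  have h2 : ∫ y in (0 : ℝ)..1,
        P.D * (P.K ⬝ᵥ (P.expA (P.D * y) *ᵥ (P.GBar *ᵥ (P.expS (P.D * (1 - y)) *ᵥ v))))
      = P.K ⬝ᵥ ∫ y in (0 : ℝ)..1,
        P.D • (P.expA (P.D * (1 - y)) *ᵥ (P.GBar *ᵥ (P.expS (P.D * y) *ᵥ v))) := by
    rw [← intervalIntegral_dotProduct _ ((continuous_exo_term _).intervalIntegrable _ _)]
    -- The controller and the predictor write the exogenous integral with opposite orientations; `y
    -- ↦ 1 - y` matches them.
    have := intervalIntegral.integral_comp_sub_left (a := 0) (b := 1) (fun y =>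
      P.K ⬝ᵥ P.D • (P.expA (P.D * (1 - y)) *ᵥ (P.GBar *ᵥ (P.expS (P.D * y) *ᵥ v)))) 1
    simp only [sub_sub_cancel, sub_self, sub_zero] at this
    rw [← this]
    refine intervalIntegral.integral_congr fun y _ => ?_
    simp only [dotProduct_smul, smul_eq_mul]
  rw [control, h1, h2, predX, div_self hD.ne', dotProduct_add, dotProduct_add]
  ring

/-- At time `t + D` the plant feels exactly `U t`, so the fundamental theorem of calculus applies
once `U` is continuous near `t`. -/
lemma hasDerivAt_response (hD : 0 < P.D) (ht : 0 < t) (hU : IntervalIntegrable U volume 0 t)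
    (hc : ∀ᶠ r in 𝓝 t, ContinuousAt U r) :
    HasDerivAt (P.response U x₀ v₀) (P.A *ᵥ P.response U x₀ v₀ (t + P.D) + U t • P.B
      + P.GBar *ᵥ (P.expS (t + P.D) *ᵥ v₀)) (t + P.D) := by
  have hint := intervalIntegrable_response (v₀ := v₀) hD ht.le hU
  have hcont : ∀ r, 0 < r → ContinuousAt U r →
      ContinuousAt (fun σ => P.expA (-σ) *ᵥ P.forcing U v₀ σ) (r + P.D) := by
    intro r hr hUr
    have h1 : ContinuousAt (P.actuator U 0) (r + P.D) := by
      have : ContinuousAt (fun σ => U (σ - P.D)) (r + P.D) :=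
        ContinuousAt.comp (g := U) (by simpa using hUr) (by fun_prop)
      refine this.congr ?_
      filter_upwards [lt_mem_nhds (show P.D < r + P.D by linarith)] with σ hσ
      simp [actuator, hσ]
    have h2 : ContinuousAt (P.forcing U v₀) (r + P.D) :=
      (h1.smul continuousAt_const).add (continuous_const.matrix_mulVec
        (P.continuous_expS.matrix_mulVec continuous_const)).continuousAt
    rw [continuousAt_pi] at h2 ⊢
    intro i
    simp only [mulVec, dotProduct]
    refine tendsto_finsetSum _ fun j _ => Tendsto.mul ?_ (h2 j)
    exact ((continuous_apply_apply i j).comp (P.continuous_expA.comp continuous_neg)).continuousAt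
  have hmeas : StronglyMeasurableAtFilter (fun σ => P.expA (-σ) *ᵥ P.forcing U v₀ σ)
      (𝓝 (t + P.D)) := by
    obtain ⟨V, hV, hVo, htV⟩ := eventually_nhds_iff.1 (hc.and (lt_mem_nhds ht))
    refine ContinuousAt.stronglyMeasurableAtFilter (s := (fun σ => σ - P.D) ⁻¹' V)
      (hVo.preimage (by fun_prop)) (fun σ hσ => ?_) _ (by simpa using htV)
    have := hcont (σ - P.D) (hV _ hσ).2 (hV _ hσ).1
    simpa using this
  have hd := intervalIntegral.integral_hasDerivAt_right hint hmeas (hcont t ht hc.self_of_nhds)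
  refine (hasDerivAt_exp_mulVec P.A (hd.const_add x₀)).congr_deriv ?_
  rw [add_assoc]
  congr 1
  change P.expA (t + P.D) *ᵥ (P.expA (-(t + P.D)) *ᵥ P.forcing U v₀ (t + P.D)) = _
  rw [mulVec_mulVec, ← expA_add, add_neg_cancel, expA_zero, one_mulVec, forcing,
    actuator_zero_add ht]

/-! ### Solutions of the closed loop are responses. -/

section Solution

variable {h : ℝ → ℝ → ℝ} {k : ℕ → ℝ} {ε tbar : ℝ} {T : EReal} {X : ℝ → Fin n → ℝ}
  {V : ℝ → Fin nd ⊕ Fin nr → ℝ}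

lemma coe_lt_of_le {s t : ℝ} (hst : s ≤ t) (hT : (t : EReal) < T) : (s : EReal) < T :=
  (EReal.coe_le_coe_iff.2 hst).trans_lt hT

lemma IsClosedLoop.V_eq (hsol : P.IsClosedLoop h k ε tbar x₀ v₀ T X V U) (ht : 0 ≤ t)
    (hT : (t : EReal) < T) : V t = P.expS t *ᵥ v₀ := by
  have := eq_exp_mulVec_add_integral P.S (x := V) (g := fun _ => 0) ht countable_empty
    (fun s hs => ((hsol.V_ode s hs.1 (coe_lt_of_le hs.2 hT)).continuousWithinAt).mono
      Icc_subset_Ici_self)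
    (fun s hs => ?_) intervalIntegrable_const
  · rw [this, hsol.V_zero]
    simp [expS]
  · simpa using (hsol.V_ode s hs.1.1.le (coe_lt_of_le hs.1.2.le hT)).hasDerivAt
      (Ici_mem_nhds hs.1.1)

/-- Variation of constants with the single exceptional time `D`, where `X` need not be
differentiable. -/
lemma IsClosedLoop.X_eq (hD : 0 < P.D) (hsol : P.IsClosedLoop h k ε tbar x₀ v₀ T X V U)
    (ht : 0 ≤ t) (hT : (t : EReal) < T) : X t = P.response U x₀ v₀ t := by
  have hint := (intervalIntegrable_forcing (v₀ := v₀) hD ht (hsol.U_int t ht hT)).mono_set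
    (c := 0) (d := t) (by
      rw [uIcc_of_le ht, uIcc_of_le (by linarith)]; exact Icc_subset_Icc_right (by linarith))
  have := eq_exp_mulVec_add_integral P.A (x := X) (g := P.forcing U v₀) ht
    (countable_singleton P.D)
    (fun s hs => (hsol.X_cont s hs.1 (coe_lt_of_le hs.2 hT)).mono Icc_subset_Ici_self)
    (fun s hs => ?_) hint
  · rw [this, hsol.X_zero]
    rfl
  · have hsT := coe_lt_of_le hs.1.2.le hT
    refine (hsol.X_ode s hs.1.1 hsT hs.2).congr_deriv ?_
    rw [forcing, hsol.V_eq hs.1.1.le hsT, add_assoc, GBar, ← mulVec_mulVec]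

/-- `Z = T_z X + T_v V` along the response, as a sequence indexed from `1`. -/
noncomputable def responseZ (P : Plant n m nd nr) (U : ℝ → ℝ) (x₀ : Fin n → ℝ)
    (v₀ : Fin nd ⊕ Fin nr → ℝ) (s : ℝ) (j : ℕ) : ℝ :=
  if hj : 1 ≤ j ∧ j ≤ n then
    (P.Tz *ᵥ P.response U x₀ v₀ s + P.Tv *ᵥ (P.expS s *ᵥ v₀)) ⟨j - 1, by omega⟩ else 0

/-- The feedback at time `t` becomes a static function of the response at `t + D`: the delay has
disappeared. -/
lemma IsClosedLoop.U_eq (hD : 0 < P.D) (hsol : P.IsClosedLoop h k ε tbar x₀ v₀ T X V U)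
    (ht : 0 ≤ t) (hT : (t : EReal) < T) :
    U t = -(P.K ⬝ᵥ P.response U x₀ v₀ (t + P.D)) - P.G0 ⬝ᵥ (P.expS (t + P.D) *ᵥ v₀)
      - driftTerm n P.b h (P.varsigma h ε tbar x₀ v₀) k (P.responseZ U x₀ v₀ (t + P.D)) (t + P.D)
        / vartheta h (P.responseZ U x₀ v₀ (t + P.D) 1) (t + P.D) := by
  have hS : P.expS P.D *ᵥ (P.expS t *ᵥ v₀) = P.expS (t + P.D) *ᵥ v₀ := by
    rw [mulVec_mulVec, ← expS_add, add_comm]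
  have hZ : P.predZ (P.response U x₀ v₀ t) (P.expS t *ᵥ v₀) (fun y => P.actuator U y t) P.D
      = P.responseZ U x₀ v₀ (t + P.D) := by
    funext j
    rw [predZ, predX_response hD ht (hsol.U_int t ht hT), hS]
    rfl
  rw [hsol.U_law t ht hT, control_eq hD _ _ _ _ _
    (intervalIntegrable_actuator_state hD ht (hsol.U_int t ht hT)), hsol.X_eq hD ht hT,
    hsol.V_eq ht hT, hZ, predX_response hD ht (hsol.U_int t ht hT), hS]

end Solution

end Plant

end DelaySafe

/-! ### The plant as a chain of integrators. -/

namespace DelaySafe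

/-- A vector as a sequence indexed from `1` and extended by zero. -/
def seqOfVec {n : ℕ} (x : Fin n → ℝ) (j : ℕ) : ℝ :=
  if hj : 1 ≤ j ∧ j ≤ n then x ⟨j - 1, by omega⟩ else 0

lemma seqOfVec_succ {n : ℕ} (x : Fin n → ℝ) (i : Fin n) : seqOfVec x (i + 1) = x i := by
  have hi : (i : ℕ) + 1 ≤ n := i.2
  simp [seqOfVec, hi]

lemma sum_fin_eq_sum_Icc {n : ℕ} (f : ℕ → ℝ) :
    ∑ j : Fin n, f (j + 1) = ∑ l ∈ Finset.Icc 1 n, f l := by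
  rw [Fin.sum_univ_eq_sum_range (fun j => f (j + 1)), Finset.range_eq_Ico, Finset.sum_Ico_add']
  rfl

lemma hasDerivAt_seqOfVec {n : ℕ} {x : ℝ → Fin n → ℝ} {x' : Fin n → ℝ} {t : ℝ}
    (hx : HasDerivAt x x' t) (j : ℕ) :
    HasDerivAt (fun s => seqOfVec (x s) j) (seqOfVec x' j) t := by
  unfold seqOfVec
  split_ifs
  · exact hasDerivAt_pi.1 hx _
  · exact hasDerivAt_const _ _

namespace Plant

variable {n m nd nr : ℕ} (P : Plant n m nd nr)

lemma aEntry_succ (i j : Fin n) : P.aEntry (i + 1) (j + 1) = P.a i j := by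
  have hi : (i : ℕ) + 1 ≤ n := i.2
  have hj : (j : ℕ) + 1 ≤ n := j.2
  simp [aEntry, hi, hj]

lemma gRow_succ (i : Fin n) : P.gRow (i + 1) = P.GBar i := by
  have hi : (i : ℕ) + 1 ≤ n := i.2
  simp [gRow, hi]

lemma rho_zero_right (i : ℕ) : P.rho i 0 = 0 := by
  cases i <;> simp [rho]

/-- The coordinate `z_{p+1}` of the plant in chain form, for `p < n`. -/
noncomputable def chainCoord (p : ℕ) (x : Fin n → ℝ) (v : Fin nd ⊕ Fin nr → ℝ) : ℝ :=
  ∑ l ∈ Finset.Icc 1 p, P.rho p l * seqOfVec x l + seqOfVec x (p + 1)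
    - (P.sigma p + P.PrBar ᵥ* P.S ^ p) ⬝ᵥ v

lemma Tz_mulVec_add_Tv_mulVec (x : Fin n → ℝ) (v : Fin nd ⊕ Fin nr → ℝ) (i : Fin n) :
    (P.Tz *ᵥ x + P.Tv *ᵥ v) i = P.chainCoord i x v := by
  have h1 : (P.Tz *ᵥ x) i = ∑ l ∈ Finset.Icc 1 (i : ℕ), P.rho i l * seqOfVec x l
      + seqOfVec x (i + 1) := by
    have e : (P.Tz *ᵥ x) i = ∑ l ∈ Finset.Icc 1 n, (if l = i + 1 then 1 else if l < i + 1 then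
        P.rho i l else 0) * seqOfVec x l := by
      rw [← sum_fin_eq_sum_Icc]
      simp only [mulVec, dotProduct, Tz, of_apply]
      refine Finset.sum_congr rfl fun j _ => ?_
      simp only [seqOfVec_succ, add_left_inj, add_lt_add_iff_right, Fin.ext_iff, Fin.lt_def]
    have hsub : Finset.Icc 1 ((i : ℕ) + 1) ⊆ Finset.Icc 1 n := Finset.Icc_subset_Icc_right i.2
    rw [e, ← Finset.sum_subset hsub, Finset.sum_Icc_succ_top (by omega)]
    · rw [if_pos rfl, one_mul]
      congr 1
      refine Finset.sum_congr rfl fun l hl => ?_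
      rw [Finset.mem_Icc] at hl
      rw [if_neg (by omega), if_pos (by omega)]
    · intro l hl hl'
      rw [Finset.mem_Icc] at hl hl'
      rw [if_neg (by omega), if_neg (by omega), zero_mul]
  have h2 : (P.Tv *ᵥ v) i = -((P.sigma i + P.PrBar ᵥ* P.S ^ (i : ℕ)) ⬝ᵥ v) := by
    rw [← neg_dotProduct]
    rfl
  rw [Pi.add_apply, h1, h2, chainCoord]
  ring

lemma err_eq (hn : 1 ≤ n) (x : Fin n → ℝ) (v : Fin nd ⊕ Fin nr → ℝ) :
    P.err x v = P.chainCoord 0 x v := by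
  have h1 : P.C ⬝ᵥ x = seqOfVec x 1 := by
    have : P.C = Pi.single (⟨0, hn⟩ : Fin n) 1 := by
      funext i
      simp [C, Pi.single_apply, Fin.ext_iff]
    rw [this, single_one_dotProduct]
    exact (seqOfVec_succ x ⟨0, hn⟩).symm
  simp [err, chainCoord, h1, sigma]

/-- The right-hand side is a virtual coordinate `z_{n+1}`, the drift of the last integrator, which
the linear part of the feedback has to cancel. -/
lemma mul_K_add_G0 (hb : P.b ≠ 0) (x : Fin n → ℝ) (v : Fin nd ⊕ Fin nr → ℝ) :
    P.b * (P.K ⬝ᵥ x + P.G0 ⬝ᵥ v) = P.chainCoord n x v := by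
  have h1 : P.b * (P.K ⬝ᵥ x) = ∑ l ∈ Finset.Icc 1 n, P.rho n l * seqOfVec x l := by
    rw [← sum_fin_eq_sum_Icc fun l => P.rho n l * seqOfVec x l, dotProduct, Finset.mul_sum]
    refine Finset.sum_congr rfl fun j _ => ?_
    rw [seqOfVec_succ, K]
    field_simp
  have h2 : P.b * (P.G0 ⬝ᵥ v) = -((P.sigma n + P.PrBar ᵥ* P.S ^ n) ⬝ᵥ v) := by
    rw [G0, neg_dotProduct, smul_dotProduct, smul_eq_mul]
    field_simp
  have h3 : seqOfVec x (n + 1) = 0 := by simp [seqOfVec]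
  rw [mul_add, h1, h2, chainCoord, h3]
  ring

lemma seqOfVec_plant (x : Fin n → ℝ) (v : Fin nd ⊕ Fin nr → ℝ) (w : ℝ) (j : ℕ) (hj : 1 ≤ j)
    (hjn : j ≤ n) :
    seqOfVec (P.A *ᵥ x + w • P.B + P.GBar *ᵥ v) j
      = ∑ l ∈ Finset.Icc 1 j, P.aEntry j l * seqOfVec x l + seqOfVec x (j + 1)
        + (if j = n then P.b * w else 0) + P.gRow j ⬝ᵥ v := by
  obtain ⟨i, rfl⟩ : ∃ i : Fin n, (i : ℕ) + 1 = j := ⟨⟨j - 1, by omega⟩, by simp; omega⟩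
  have hA : (P.A *ᵥ x) i = ∑ l ∈ Finset.Icc 1 ((i : ℕ) + 1), P.aEntry (i + 1) l * seqOfVec x l
      + seqOfVec x (i + 1 + 1) := by
    have e : (P.A *ᵥ x) i = ∑ l ∈ Finset.Icc 1 n, (if l ≤ i + 1 then P.aEntry (i + 1) l else
        if l = i + 1 + 1 then 1 else 0) * seqOfVec x l := by
      rw [← sum_fin_eq_sum_Icc]
      simp only [mulVec, dotProduct, A, of_apply]
      refine Finset.sum_congr rfl fun j _ => ?_
      simp only [seqOfVec_succ, aEntry_succ, add_left_inj, add_le_add_iff_right, Fin.le_def]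
    have hsub : Finset.Icc 1 ((i : ℕ) + 1) ⊆ Finset.Icc 1 n := Finset.Icc_subset_Icc_right i.2
    rw [e, ← Finset.sum_sdiff hsub, add_comm]
    congr 1
    · refine Finset.sum_congr rfl fun l hl => ?_
      rw [if_pos (Finset.mem_Icc.1 hl).2]
    · by_cases hi : (i : ℕ) + 1 + 1 ≤ n
      · rw [Finset.sum_eq_single ((i : ℕ) + 1 + 1)]
        · simp
        · intro l hl hl'
          simp only [Finset.mem_sdiff, Finset.mem_Icc] at hl
          rw [if_neg (by omega), if_neg hl', zero_mul]
        · intro hl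
          simp only [Finset.mem_sdiff, Finset.mem_Icc] at hl
          omega
      · rw [Finset.sum_eq_zero]
        · simp [seqOfVec, hi]
        · intro l hl
          simp only [Finset.mem_sdiff, Finset.mem_Icc] at hl
          omega
  rw [seqOfVec_succ, Pi.add_apply, Pi.add_apply, hA, gRow_succ, Pi.smul_apply, B, smul_eq_mul]
  congr 2
  split_ifs <;> ring

/-- The chain coordinates of the plant form a chain of integrators. -/
lemma chainCoord_plant (x : Fin n → ℝ) (v : Fin nd ⊕ Fin nr → ℝ) (w : ℝ) (p : ℕ) (hp : p < n) :
    P.chainCoord p (P.A *ᵥ x + w • P.B + P.GBar *ᵥ v) (P.S *ᵥ v)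
      = P.chainCoord (p + 1) x v + if p + 1 = n then P.b * w else 0 := by
  have h1 : ∑ l ∈ Finset.Icc 1 p, P.rho p l * seqOfVec (P.A *ᵥ x + w • P.B + P.GBar *ᵥ v) l
      = ∑ j ∈ Finset.Icc 1 p, ∑ l ∈ Finset.Icc 1 j, P.rho p j * P.aEntry j l * seqOfVec x l
        + ∑ j ∈ Finset.Icc 1 p, P.rho p j * seqOfVec x (j + 1)
        + (∑ j ∈ Finset.Icc 1 p, P.rho p j • P.gRow j) ⬝ᵥ v := by
    rw [sum_dotProduct, ← Finset.sum_add_distrib, ← Finset.sum_add_distrib]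
    refine Finset.sum_congr rfl fun j hj => ?_
    rw [Finset.mem_Icc] at hj
    rw [P.seqOfVec_plant x v w j hj.1 (by omega), if_neg (by omega), smul_dotProduct, smul_eq_mul,
      add_zero, mul_add, mul_add, Finset.mul_sum]
    simp only [mul_assoc]
  have h2 : ∑ l ∈ Finset.Icc 1 (p + 1), P.rho (p + 1) l * seqOfVec x l
      = ∑ l ∈ Finset.Icc 1 (p + 1), P.aEntry (p + 1) l * seqOfVec x l
        + ∑ j ∈ Finset.Icc 1 p, P.rho p j * seqOfVec x (j + 1)
        + ∑ j ∈ Finset.Icc 1 p, ∑ l ∈ Finset.Icc 1 j, P.rho p j * P.aEntry j l * seqOfVec x l := by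
    have e1 : ∑ j ∈ Finset.Icc 1 p, P.rho p j * seqOfVec x (j + 1)
        = ∑ l ∈ Finset.Icc 1 (p + 1), P.rho p (l - 1) * seqOfVec x l := by
      -- After the index shift the term `l = 1` contains `ϱ_{p,0} = 0`.
      rw [← Finset.add_sum_Ioc_eq_sum_Icc (by omega : 1 ≤ p + 1)]
      simp only [Nat.sub_self, rho_zero_right, zero_mul, zero_add]
      refine Finset.sum_bij' (fun j _ => j + 1) (fun l _ => l - 1) ?_ ?_ ?_ ?_ ?_ <;>
        simp only [Finset.mem_Icc, Finset.mem_Ioc] <;> intros <;> first | omega | rfl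
    have e2 : ∑ j ∈ Finset.Icc 1 p, ∑ l ∈ Finset.Icc 1 j, P.rho p j * P.aEntry j l * seqOfVec x l
        = ∑ l ∈ Finset.Icc 1 (p + 1), ∑ j ∈ Finset.Icc l p,
          P.rho p j * P.aEntry j l * seqOfVec x l := by
      -- The triangular sum is read by columns; the added column `l = p + 1` is empty.
      refine Finset.sum_comm' fun j l => ?_
      simp only [Finset.mem_Icc]
      omega
    rw [e1, e2, ← Finset.sum_add_distrib, ← Finset.sum_add_distrib]
    refine Finset.sum_congr rfl fun l hl => ?_
    rw [rho, if_pos (Finset.mem_Icc.1 hl), add_mul, add_mul, Finset.sum_mul]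
  have h3 : (P.sigma (p + 1) + P.PrBar ᵥ* P.S ^ (p + 1)) ⬝ᵥ v
      = (P.sigma p + P.PrBar ᵥ* P.S ^ p) ⬝ᵥ (P.S *ᵥ v)
        - (∑ j ∈ Finset.Icc 1 p, P.rho p j • P.gRow j) ⬝ᵥ v - P.gRow (p + 1) ⬝ᵥ v := by
    rw [sigma, dotProduct_mulVec, add_vecMul, vecMul_vecMul, pow_succ]
    simp only [add_dotProduct, sub_dotProduct, neg_dotProduct]
    ring
  rw [chainCoord, chainCoord, h1, h2, h3, P.seqOfVec_plant x v w (p + 1) (by omega) hp]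
  ring

variable {P} {U : ℝ → ℝ} {x₀ : Fin n → ℝ} {v₀ : Fin nd ⊕ Fin nr → ℝ} {t : ℝ}

lemma responseZ_succ {p : ℕ} (hp : p < n) (s : ℝ) :
    P.responseZ U x₀ v₀ s (p + 1) = P.chainCoord p (P.response U x₀ v₀ s) (P.expS s *ᵥ v₀) := by
  have hp' : p + 1 ≤ n := hp
  rw [responseZ, dif_pos ⟨by omega, hp'⟩]
  exact P.Tz_mulVec_add_Tv_mulVec _ _ ⟨p, hp⟩

lemma hasDerivAt_responseZ (hD : 0 < P.D) (ht : 0 < t) (hU : IntervalIntegrable U volume 0 t)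
    (hc : ∀ᶠ r in 𝓝 t, ContinuousAt U r) {p : ℕ} (hp : p < n) :
    HasDerivAt (fun s => P.responseZ U x₀ v₀ s (p + 1))
      (P.chainCoord (p + 1) (P.response U x₀ v₀ (t + P.D)) (P.expS (t + P.D) *ᵥ v₀)
        + if p + 1 = n then P.b * U t else 0) (t + P.D) := by
  have hY := hasDerivAt_response (x₀ := x₀) (v₀ := v₀) hD ht hU hc
  have hV := P.hasDerivAt_expS_mulVec v₀ (t + P.D)
  have hV' : HasDerivAt (fun s => (P.sigma p + P.PrBar ᵥ* P.S ^ p) ⬝ᵥ (P.expS s *ᵥ v₀))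
      ((P.sigma p + P.PrBar ᵥ* P.S ^ p) ⬝ᵥ (P.S *ᵥ (P.expS (t + P.D) *ᵥ v₀))) (t + P.D) :=
    HasDerivAt.fun_sum (u := Finset.univ) fun j _ => (hasDerivAt_pi.1 hV j).const_mul _
  rw [← chainCoord_plant _ _ _ _ _ hp]
  refine HasDerivAt.congr_of_eventuallyEq ?_ (Eventually.of_forall fun s => responseZ_succ hp s)
  exact ((HasDerivAt.fun_sum fun l _ => (hasDerivAt_seqOfVec hY l).const_mul _).add
    (hasDerivAt_seqOfVec hY _)).sub hV'

lemma continuousOn_responseZ (hD : 0 < P.D) (ht : 0 ≤ t) (hU : IntervalIntegrable U volume 0 t) :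
    ContinuousOn (P.responseZ U x₀ v₀) (Icc 0 (t + P.D)) := by
  refine continuousOn_pi.2 fun j => ?_
  unfold responseZ
  split_ifs with hj
  · have hY := continuousOn_response (x₀ := x₀) (v₀ := v₀) hD ht hU
    have h1 : ContinuousOn (fun s => P.Tz *ᵥ P.response U x₀ v₀ s) (Icc 0 (t + P.D)) :=
      (continuous_const.matrix_mulVec continuous_id).comp_continuousOn hY
    have h2 : Continuous (fun s => P.Tv *ᵥ (P.expS s *ᵥ v₀)) :=
      continuous_const.matrix_mulVec (P.continuous_expS.matrix_mulVec continuous_const)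
    exact (continuousOn_pi.1 (h1.add h2.continuousOn) _)
  · exact continuousOn_const

end Plant

end DelaySafe

/-! ### Exponential decay in the cascade and bounds for the coordinates. -/

namespace DelaySafe

/-- Exponential decay of the solutions of a stable scalar equation with decaying input. -/
lemma abs_le_of_hasDerivAt_decay {J : Set ℝ} {a k l C : ℝ} {y w : ℝ → ℝ}
    (hJ : ∀ s ∈ J, Icc a s ⊆ J) (hl : l < k) (hC : 0 ≤ C) (hy : ContinuousOn y J)
    (hd : ∀ s ∈ J, a < s → HasDerivAt y (w s - k * y s) s)
    (hw : ∀ s ∈ J, |w s| ≤ C * Real.exp (-l * (s - a))) :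
    ∀ s ∈ J, a ≤ s → |y s| ≤ (|y a| + C / (k - l)) * Real.exp (-l * (s - a)) := by
  intro s hs has
  have hkl : 0 < k - l := sub_pos.2 hl
  -- With the integrating factor, `u' = e^{k(x-a)} w`, and `B` is chosen so that `B'` dominates
  -- `|u'|`. Hence `B - u` and `B + u` are both monotone, which bounds `|u|`.
  let B : ℝ → ℝ := fun x => C / (k - l) * Real.exp ((k - l) * (x - a))
  let u : ℝ → ℝ := fun x => Real.exp (k * (x - a)) * y x
  have hBd : ∀ x, HasDerivAt B (C * Real.exp ((k - l) * (x - a))) x := by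
    intro x
    have := ((((hasDerivAt_id' x).sub_const a).const_mul (k - l)).exp).const_mul (C / (k - l))
    refine this.congr_deriv ?_
    field_simp
  have hud : ∀ x ∈ J, a < x → HasDerivAt u (Real.exp (k * (x - a)) * w x) x := by
    intro x hx hax
    have h1 := (((hasDerivAt_id' x).sub_const a).const_mul k).exp
    refine (h1.mul (hd x hx hax)).congr_deriv ?_
    ring
  have huc : ContinuousOn u (Icc a s) :=
    (Continuous.continuousOn (by fun_prop)).mul (hy.mono (hJ s hs))
  have hBc : ContinuousOn B (Icc a s) := fun x _ => (hBd x).continuousAt.continuousWithinAt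
  have hbound : ∀ x ∈ J, |Real.exp (k * (x - a)) * w x| ≤ C * Real.exp ((k - l) * (x - a)) := by
    intro x hx
    rw [abs_mul, Real.abs_exp]
    calc Real.exp (k * (x - a)) * |w x|
        ≤ Real.exp (k * (x - a)) * (C * Real.exp (-l * (x - a))) :=
          mul_le_mul_of_nonneg_left (hw x hx) (Real.exp_pos _).le
      _ = C * (Real.exp (k * (x - a)) * Real.exp (-l * (x - a))) := by ring
      _ = C * Real.exp ((k - l) * (x - a)) := by
          rw [← Real.exp_add]
          ring_nf
  have hint : ∀ x ∈ interior (Icc a s), x ∈ J ∧ a < x := by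
    intro x hx
    rw [interior_Icc] at hx
    exact ⟨hJ s hs ⟨hx.1.le, hx.2.le⟩, hx.1⟩
  have m1 : MonotoneOn (fun x => B x - u x) (Icc a s) :=
    monotoneOn_of_hasDerivWithinAt_nonneg (convex_Icc a s) (hBc.sub huc)
      (fun x hx => ((hBd x).sub (hud x (hint x hx).1 (hint x hx).2)).hasDerivWithinAt)
      fun x hx => by
        have := (abs_le.1 (hbound x (hint x hx).1)).2
        linarith
  have m2 : MonotoneOn (fun x => B x + u x) (Icc a s) :=
    monotoneOn_of_hasDerivWithinAt_nonneg (convex_Icc a s) (hBc.add huc)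
      (fun x hx => ((hBd x).add (hud x (hint x hx).1 (hint x hx).2)).hasDerivWithinAt)
      fun x hx => by
        have := (abs_le.1 (hbound x (hint x hx).1)).1
        linarith
  have e1 := m1 (left_mem_Icc.2 has) (right_mem_Icc.2 has) has
  have e2 := m2 (left_mem_Icc.2 has) (right_mem_Icc.2 has) has
  have hBa : 0 ≤ B a := mul_nonneg (div_nonneg hC hkl.le) (Real.exp_pos _).le
  have hua : u a = y a := by simp [u]
  have hu : |u s| ≤ B s + |y a| := by
    have h1 := le_abs_self (y a)
    have h2 := neg_abs_le (y a)
    rw [abs_le]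
    simp only [hua] at e1 e2
    constructor <;> linarith
  have hys : y s = Real.exp (-(k * (s - a))) * u s := by
    simp only [u]
    rw [← mul_assoc, ← Real.exp_add]
    simp
  rw [hys, abs_mul, Real.abs_exp]
  have h3 : Real.exp (-(k * (s - a))) ≤ Real.exp (-l * (s - a)) := by
    apply Real.exp_le_exp.2
    nlinarith [mul_nonneg hkl.le (sub_nonneg.2 has)]
  have h4 : Real.exp (-(k * (s - a))) * B s = C / (k - l) * Real.exp (-l * (s - a)) := by
    simp only [B]
    rw [mul_left_comm, ← Real.exp_add]
    ring_nf
  calc Real.exp (-(k * (s - a))) * |u s| ≤ Real.exp (-(k * (s - a))) * (B s + |y a|) :=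
        mul_le_mul_of_nonneg_left hu (Real.exp_pos _).le
    _ = C / (k - l) * Real.exp (-l * (s - a)) + Real.exp (-(k * (s - a))) * |y a| := by
        rw [mul_add, h4]
    _ ≤ C / (k - l) * Real.exp (-l * (s - a)) + Real.exp (-l * (s - a)) * |y a| := by gcongr
    _ = _ := by ring

section Chain

variable {h : ℝ → ℝ → ℝ} {σ : ℝ → ℝ} {n : ℕ} {k : ℕ → ℝ} {J : Set ℝ} {a : ℝ} {z : ℝ → ℕ → ℝ}

/-- `ϑ` is the leading partial derivative of `h_1`, and the choice of recovery function and gains is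
irrelevant; zero is taken for both. -/
lemma isTame_vartheta (hn : 1 ≤ n) (hh : IsBarrier n h) :
    IsTame h 1 fun z t => vartheta h (z 1) t := by
  have hσ : ∀ m : ℕ, ContDiff ℝ m fun _ : ℝ => (0 : ℝ) := fun m => contDiff_const
  have h0 : ∃ c : ℝ, ∀ t, c < t → (fun _ : ℝ => (0 : ℝ)) t = 0 := ⟨0, fun _ _ => rfl⟩
  have h1 := isRegular_cbf hh hσ h0 0 0 (by omega)
  obtain ⟨r, rfl⟩ : ∃ r, n = r + 1 := ⟨n - 1, by omega⟩
  exact ((IsRegular.pderivZ (r := r) h1 1).congr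
    fun z t ht => pderivZ_cbf hh hσ h0 0 0 (by omega) z ht).isTame

lemma isTame_cbfRest (hh : IsBarrier n h) (hσ : ∀ m : ℕ, ContDiff ℝ m σ)
    (hσ0 : ∃ c, ∀ t, c < t → σ t = 0) {i : ℕ} (hi : i < n) :
    IsTame h (i + 1) (cbfRest h σ k (i + 1)) := by
  have h1 := isRegular_cbf hh hσ hσ0 k i hi
  obtain ⟨r, hr⟩ : ∃ r, n - i = r + 1 := ⟨n - i - 1, by omega⟩
  rw [hr] at h1
  exact h1.cbfRest.isTame

lemma continuousOn_curve {N : ℕ} {F : (ℕ → ℝ) → ℝ → ℝ} (hF : IsTame h N F) (ha : 0 < a)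
    (haJ : ∀ s ∈ J, a ≤ s) (hz : ContinuousOn z J) : ContinuousOn (fun s => F (z s) s) J :=
  hF.cont.comp (hz.prodMk continuousOn_id) fun s hs => ⟨mem_univ _, ha.trans_le (haJ s hs)⟩

/-- Along the controlled chain of integrators all the functions `cbf` decay exponentially. -/
lemma exists_cbf_decay (hn : 1 ≤ n) (hh : IsBarrier n h) (hσ : ∀ m : ℕ, ContDiff ℝ m σ)
    (hσ0 : ∃ c, ∀ t, c < t → σ t = 0) (hk : ∀ i, 1 ≤ i → i ≤ n → 0 < k i) (ha : 0 < a)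
    (haJ : ∀ s ∈ J, a ≤ s) (hJ : ∀ s ∈ J, Icc a s ⊆ J) (hz : ContinuousOn z J)
    (hd : ∀ s ∈ J, a < s → ∀ p < n, HasDerivAt (fun r => z r (p + 1))
      (if p + 1 = n then -(cbfRest h σ k n (z s) s / vartheta h (z s 1) s) else z s (p + 2)) s) :
    ∃ l, 0 < l ∧ ∀ i, i < n → ∃ C, 0 ≤ C ∧
      ∀ s ∈ J, |cbf h σ k (i + 1) (z s) s| ≤ C * Real.exp (-l * (s - a)) := by
  -- Half the smallest gain serves as common rate: it lies strictly below every `k i`, so no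
  -- resonance occurs in the cascade.
  obtain ⟨i₀, hi₀, hmin⟩ := Finset.exists_min_image (Finset.Icc 1 n) k ⟨1, by simp [hn]⟩
  rw [Finset.mem_Icc] at hi₀
  have hk0 := hk i₀ hi₀.1 hi₀.2
  refine ⟨k i₀ / 2, by linarith, ?_⟩
  have hlk : ∀ i, 1 ≤ i → i ≤ n → k i₀ / 2 < k i := fun i h1 h2 => by
    have := hmin i (Finset.mem_Icc.2 ⟨h1, h2⟩)
    linarith
  have hder : ∀ i < n, ∀ s ∈ J, a < s → HasDerivAt (fun r => cbf h σ k (i + 1) (z r) r)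
      ((if i + 1 = n then 0 else cbf h σ k (i + 2) (z s) s)
        - k (i + 1) * cbf h σ k (i + 1) (z s) s) s := by
    intro i hi s hs has
    have h1 := isRegular_cbf hh hσ hσ0 k i hi
    obtain ⟨r, hr⟩ : ∃ r, n - i = r + 1 := ⟨n - i - 1, by omega⟩
    rw [hr] at h1
    have hs0 : 0 < s := ha.trans has
    have h2 := h1.hasPartials z (fun j => if j = n then
        -(cbfRest h σ k n (z s) s / vartheta h (z s 1) s) else z s (j + 1)) (fun r => r) 1 s hs0
      (fun j hj => ?_) (hasDerivAt_id' s)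
    · refine h2.congr_deriv ?_
      -- The top summand is `ϑ` times the velocity of the newest coordinate. In the last equation
      -- this velocity is the feedback, where division by `ϑ` cancels the factor and leaves `-k_n
      -- h_n`.
      rw [Finset.sum_Icc_succ_top (by omega), Finset.sum_congr rfl fun j hj => by
        rw [if_neg (by rw [Finset.mem_Icc] at hj; omega)], pderivZ_cbf hh hσ hσ0 k i hi _ hs0]
      split_ifs with hin
      · have hv := hh.deriv_ne_zero (z s 1) s hs0.le
        subst hin
        have hr : cbfRest h σ k (i + 1) (z s) s
            = (∑ j ∈ Finset.Icc 1 i, pderivZ (cbf h σ k (i + 1)) j (z s) s * z s (j + 1))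
              + pderivT (cbf h σ k (i + 1)) (z s) s
              + k (i + 1) * cbf h σ k (i + 1) (z s) s := rfl
        rw [mul_neg, mul_div_cancel₀ _ hv, hr]
        ring
      · rw [cbf_succ_eq, cbfRest, pderivZ_cbf hh hσ hσ0 k i hi _ hs0, Nat.add_sub_cancel]
        ring
    · rw [Finset.mem_Icc] at hj
      obtain ⟨p, rfl⟩ : ∃ p, j = p + 1 := ⟨j - 1, by omega⟩
      exact hd s hs has p (by omega)
  have hcont : ∀ i < n, ContinuousOn (fun s => cbf h σ k (i + 1) (z s) s) J := fun i hi =>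
    continuousOn_curve (isRegular_cbf hh hσ hσ0 k i hi).isTame ha haJ hz
  intro i hi
  -- The induction runs downwards from `h_n`, the only equation of the cascade without input.
  obtain ⟨q, hq⟩ : ∃ q, q + 1 + i = n := ⟨n - 1 - i, by omega⟩
  induction q generalizing i with
  | zero =>
    have := abs_le_of_hasDerivAt_decay (C := 0) (w := fun _ => 0) hJ
      (hlk (i + 1) (by omega) (by omega)) le_rfl (hcont i hi)
      (fun s hs has => by simpa [show i + 1 = n by omega] using hder i hi s hs has)
      (fun s hs => by simp)
    exact ⟨_, by simp, fun s hs => this s hs (haJ s hs)⟩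
  | succ q ih =>
    obtain ⟨C, hC, hCs⟩ := ih (i + 1) (by omega) (by omega)
    have hki := hlk (i + 1) (by omega) (by omega)
    have := abs_le_of_hasDerivAt_decay (w := fun s => cbf h σ k (i + 2) (z s) s) hJ
      hki hC (hcont i hi)
      (fun s hs has => by simpa [show i + 1 ≠ n by omega] using hder i hi s hs has) hCs
    exact ⟨_, add_nonneg (abs_nonneg _) (div_nonneg hC (sub_nonneg.2 hki.le)),
      fun s hs => this s hs (haJ s hs)⟩

/-- Bounds for the functions `cbf` along a curve give bounds for the curve. -/
lemma exists_bound_of_cbf_bound (hn : 1 ≤ n) (hh : IsBarrier n h) (hσ : ∀ m : ℕ, ContDiff ℝ m σ)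
    (hσ0 : ∃ c, ∀ t, c < t → σ t = 0) (ha : 0 < a) (haJ : ∀ s ∈ J, a ≤ s)
    (hb : ∀ i < n, ∃ C, ∀ s ∈ J, |cbf h σ k (i + 1) (z s) s| ≤ C) :
    ∃ M, ∀ s ∈ J, |h (z s 1) s| ≤ M ∧ ∀ j ∈ Finset.Icc 1 n, |z s j| ≤ M := by
  suffices H : ∀ i, i < n → ∃ M, ∀ s ∈ J,
      |h (z s 1) s| ≤ M ∧ ∀ j ∈ Finset.Icc 1 (i + 1), |z s j| ≤ M by
    have := H (n - 1) (by omega)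
    rwa [Nat.sub_add_cancel hn] at this
  intro i
  induction i with
  | zero =>
    intro hi
    obtain ⟨C, hC⟩ := hb 0 hi
    obtain ⟨c, hc⟩ := exists_bound_of_continuous_of_eq_zero (hσ 0).continuous hσ0
    have hM : ∀ s ∈ J, |h (z s 1) s| ≤ C + c := by
      intro s hs
      have h1 := hC s hs
      have h2 := hc s (ha.trans_le (haJ s hs))
      have e : h (z s 1) s = cbf h σ k 1 (z s) s - σ s := by simp [cbf]
      rw [e]
      exact (abs_sub _ _).trans (add_le_add h1 h2)
    obtain ⟨R, hR⟩ := hh.bdd_of_bdd (C + c)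
    refine ⟨max (C + c) R, fun s hs => ⟨(hM s hs).trans (le_max_left _ _), fun j hj => ?_⟩⟩
    obtain rfl : j = 1 := by simpa using hj
    exact (hR _ s (ha.trans_le (haJ s hs)).le (hM s hs)).trans (le_max_right _ _)
  | succ i ih =>
    intro hi
    obtain ⟨M, hM⟩ := ih (by omega)
    obtain ⟨C, hC⟩ := hb (i + 1) hi
    obtain ⟨d, hd⟩ := (isTame_cbfRest (k := k) hh hσ hσ0 (i := i) (by omega)).bdd M
    obtain ⟨c, hc0, hc⟩ := hh.deriv_away M
    refine ⟨max M ((C + d) / c), fun s hs => ⟨(hM s hs).1.trans (le_max_left _ _), fun j hj => ?_⟩⟩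
    have hs0 := ha.trans_le (haJ s hs)
    rw [Finset.mem_Icc] at hj
    by_cases hji : j ≤ i + 1
    · exact ((hM s hs).2 j (Finset.mem_Icc.2 ⟨hj.1, hji⟩)).trans (le_max_left _ _)
    obtain rfl : j = i + 2 := by omega
    refine le_trans ?_ (le_max_right _ _)
    rw [le_div_iff₀ hc0]
    have h1 := hc (z s 1) s ((hM s hs).2 1 (by simp)) hs0.le
    -- The newest coordinate is solved for; the rest involves only coordinates that are already
    -- bounded.
    have e : vartheta h (z s 1) s * z s (i + 2)
        = cbf h σ k (i + 2) (z s) s - cbfRest h σ k (i + 1) (z s) s := by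
      rw [cbf_succ_eq, pderivZ_cbf hh hσ hσ0 k i (by omega) _ hs0]
      ring
    calc |z s (i + 2)| * c ≤ |z s (i + 2)| * |vartheta h (z s 1) s| := by gcongr
      _ = |vartheta h (z s 1) s * z s (i + 2)| := by rw [abs_mul, mul_comm]
      _ ≤ |cbf h σ k (i + 2) (z s) s| + |cbfRest h σ k (i + 1) (z s) s| := by
        rw [e]
        exact abs_sub _ _
      _ ≤ C + d := add_le_add (hC s hs) (hd _ s hs0 (hM s hs).1 (hM s hs).2)

end Chain

end DelaySafe

/-! ### The closed loop on the interval of predicted times. -/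

namespace DelaySafe

lemma exists_mulVec_bound {ι κ : Type*} [Fintype ι] [Fintype κ] (E : Matrix ι κ ℝ) :
    ∃ C, 0 ≤ C ∧ ∀ v, ‖E *ᵥ v‖ ≤ C * ‖v‖ :=
  ⟨_, norm_nonneg (LinearMap.toContinuousLinearMap E.mulVecLin),
    fun v => (LinearMap.toContinuousLinearMap E.mulVecLin).le_opNorm v⟩

lemma exists_dotProduct_bound {κ : Type*} [Fintype κ] (c : κ → ℝ) :
    ∃ C, 0 ≤ C ∧ ∀ v, |c ⬝ᵥ v| ≤ C * ‖v‖ := by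
  obtain ⟨C, hC, h⟩ := exists_mulVec_bound (Matrix.of fun _ : Unit => c)
  exact ⟨C, hC, fun v => (norm_le_pi_norm (Matrix.of (fun _ : Unit => c) *ᵥ v) ()).trans (h v)⟩

namespace Plant

variable {n m nd nr : ℕ} {P : Plant n m nd nr} {h : ℝ → ℝ → ℝ} {k : ℕ → ℝ} {ε tbar : ℝ}
  {T : EReal} {X : ℝ → Fin n → ℝ} {V : ℝ → Fin nd ⊕ Fin nr → ℝ} {U : ℝ → ℝ} {x₀ : Fin n → ℝ}
  {v₀ : Fin nd ⊕ Fin nr → ℝ}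

lemma isUnit_det_Tz : IsUnit P.Tz.det := by
  rw [Matrix.det_of_isLowerTriangular]
  · simp [Tz]
  · intro i j hij
    have hij' : i < j := hij
    simp [Tz, hij'.ne', hij'.not_gt]

/-- The interval on which the predicted states of a closed loop on `[0, T)` live. -/
def predInterval (P : Plant n m nd nr) (T : EReal) : Set ℝ :=
  {s | P.D ≤ s ∧ ((s - P.D : ℝ) : EReal) < T}

lemma contDiff_varsigma (r : ℕ) : ContDiff ℝ r (P.varsigma h ε tbar x₀ v₀) :=
  contDiff_recovery _ _ _ _ _

lemma varsigma_eq_zero : ∃ c, ∀ t, c < t → P.varsigma h ε tbar x₀ v₀ t = 0 :=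
  ⟨P.D + tbar, fun _ ht => recovery_eq_zero ht.le⟩

lemma Icc_subset_predInterval {s : ℝ} (hs : s ∈ P.predInterval T) :
    Icc P.D s ⊆ P.predInterval T := fun r hr =>
  ⟨hr.1, coe_lt_of_le (by linarith [hr.2]) hs.2⟩

/-- The interval is open on the right, so a property on all `Icc P.D s` yields continuity at its
points, including `D`. -/
lemma exists_gt_mem_predInterval {s : ℝ} (hs : s ∈ P.predInterval T) :
    ∃ r ∈ P.predInterval T, s < r := by
  obtain ⟨x, hx1, hx2⟩ := EReal.lt_iff_exists_real_btwn.1 hs.2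
  have hx : s - P.D < x := EReal.coe_lt_coe_iff.1 hx1
  exact ⟨x + P.D, ⟨by linarith [hs.1], by simpa using hx2⟩, by linarith⟩

lemma predInterval_mem_nhds {s : ℝ} (hs : s ∈ P.predInterval T) (hDs : P.D < s) :
    P.predInterval T ∈ 𝓝 s := by
  obtain ⟨r, hr, hsr⟩ := exists_gt_mem_predInterval hs
  exact mem_of_superset (Icc_mem_nhds hDs hsr) (Icc_subset_predInterval hr)

lemma continuousOn_predInterval {E : Type*} [TopologicalSpace E] {f : ℝ → E}
    (hf : ∀ s ∈ P.predInterval T, ContinuousOn f (Icc P.D s)) :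
    ContinuousOn f (P.predInterval T) := by
  intro s hs
  obtain ⟨r, hr, hsr⟩ := exists_gt_mem_predInterval hs
  refine (hf r hr s ⟨hs.1, hsr.le⟩).mono_of_mem_nhdsWithin ?_
  filter_upwards [self_mem_nhdsWithin, mem_nhdsWithin_of_mem_nhds (gt_mem_nhds hsr)] with x hx hxr
  exact ⟨hx.1, le_of_lt hxr⟩

namespace IsClosedLoop

lemma continuousOn_response (hD : 0 < P.D) (hsol : P.IsClosedLoop h k ε tbar x₀ v₀ T X V U) :
    ContinuousOn (P.response U x₀ v₀) (P.predInterval T) := by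
  refine continuousOn_predInterval fun s hs => ?_
  have h0 : 0 ≤ s - P.D := sub_nonneg.2 hs.1
  have := Plant.continuousOn_response (x₀ := x₀) (v₀ := v₀) hD h0 (hsol.U_int _ h0 hs.2)
  rw [sub_add_cancel] at this
  exact this.mono (Icc_subset_Icc_left hD.le)

lemma continuousOn_responseZ (hD : 0 < P.D)
    (hsol : P.IsClosedLoop h k ε tbar x₀ v₀ T X V U) :
    ContinuousOn (P.responseZ U x₀ v₀) (P.predInterval T) := by
  refine continuousOn_predInterval fun s hs => ?_
  have h0 : 0 ≤ s - P.D := sub_nonneg.2 hs.1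
  have := Plant.continuousOn_responseZ (x₀ := x₀) (v₀ := v₀) hD h0 (hsol.U_int _ h0 hs.2)
  rw [sub_add_cancel] at this
  exact this.mono (Icc_subset_Icc_left hD.le)

/-- The feedback law in predicted time; `f` is by definition `1 / b` times `cbfRest` at index `n`.
-/
lemma U_sub_eq (hD : 0 < P.D) (hsol : P.IsClosedLoop h k ε tbar x₀ v₀ T X V U) {s : ℝ}
    (hs : s ∈ P.predInterval T) :
    U (s - P.D) = -(P.K ⬝ᵥ P.response U x₀ v₀ s) - P.G0 ⬝ᵥ (P.expS s *ᵥ v₀)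
      - (1 / P.b) * cbfRest h (P.varsigma h ε tbar x₀ v₀) k n (P.responseZ U x₀ v₀ s) s
        / vartheta h (P.responseZ U x₀ v₀ s 1) s := by
  have := hsol.U_eq hD (sub_nonneg.2 hs.1) hs.2
  rwa [sub_add_cancel] at this

lemma isTame_cbfRest_varsigma (hn : 1 ≤ n) (hh : IsBarrier n h) :
    IsTame h n (cbfRest h (P.varsigma h ε tbar x₀ v₀) k n) := by
  obtain ⟨i, rfl⟩ : ∃ i, n = i + 1 := ⟨n - 1, by omega⟩
  exact isTame_cbfRest hh contDiff_varsigma varsigma_eq_zero (Nat.lt_succ_self i)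

/-- A bootstrap: `U` is only assumed integrable, but this makes the response continuous, and the
feedback law passes continuity on to `U`. It is what allows the response to be differentiated. -/
lemma continuousAt_U (hn : 1 ≤ n) (hh : IsBarrier n h) (hD : 0 < P.D)
    (hsol : P.IsClosedLoop h k ε tbar x₀ v₀ T X V U) {s : ℝ} (hs : s ∈ P.predInterval T)
    (hDs : P.D < s) : ContinuousAt U (s - P.D) := by
  have hle : ∀ s ∈ P.predInterval T, P.D ≤ s := fun s hs => hs.1
  have hz := hsol.continuousOn_responseZ hD
  have hvpos : ∀ s ∈ P.predInterval T, vartheta h (P.responseZ U x₀ v₀ s 1) s ≠ 0 :=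
    fun s hs => hh.deriv_ne_zero _ _ (hD.le.trans hs.1)
  have hK : ContinuousOn (fun s => P.K ⬝ᵥ P.response U x₀ v₀ s) (P.predInterval T) :=
    (continuous_const.dotProduct continuous_id).comp_continuousOn (hsol.continuousOn_response hD)
  have hG : Continuous fun s => P.G0 ⬝ᵥ (P.expS s *ᵥ v₀) :=
    continuous_const.dotProduct (P.continuous_expS.matrix_mulVec continuous_const)
  have hf := (hK.neg.sub hG.continuousOn).sub ((continuousOn_const (c := 1 / P.b)).mul
    (continuousOn_curve (isTame_cbfRest_varsigma (k := k) (ε := ε) (tbar := tbar) (x₀ := x₀)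
      (v₀ := v₀) (P := P) hn hh) hD hle hz) |>.div
    (continuousOn_curve (isTame_vartheta hn hh) hD hle hz) hvpos)
  have hc : ContinuousOn (fun s => U (s - P.D)) (P.predInterval T) :=
    hf.congr fun s hs => hsol.U_sub_eq hD hs
  have hc' : ContinuousAt (fun s => U (s - P.D)) (s - P.D + P.D) := by
    rw [sub_add_cancel]
    exact hc.continuousAt (predInterval_mem_nhds hs hDs)
  have := ContinuousAt.comp (f := fun t : ℝ => t + P.D) (x := s - P.D) hc' (by fun_prop)
  simpa [Function.comp_def] using this

/-- In the last equation the virtual coordinate `z_{n+1}` cancels against `b` times the linear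
feedback, leaving only the term with `ϑ`. -/
lemma hasDerivAt_responseZ (hn : 1 ≤ n) (hh : IsBarrier n h) (hb : 0 < P.b) (hD : 0 < P.D)
    (hsol : P.IsClosedLoop h k ε tbar x₀ v₀ T X V U) {s : ℝ} (hs : s ∈ P.predInterval T)
    (hDs : P.D < s) {p : ℕ} (hp : p < n) :
    HasDerivAt (fun r => P.responseZ U x₀ v₀ r (p + 1))
      (if p + 1 = n then -(cbfRest h (P.varsigma h ε tbar x₀ v₀) k n (P.responseZ U x₀ v₀ s) s
        / vartheta h (P.responseZ U x₀ v₀ s 1) s) else P.responseZ U x₀ v₀ s (p + 2)) s := by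
  have h0 : 0 < s - P.D := sub_pos.2 hDs
  have hev : ∀ᶠ r in 𝓝 (s - P.D), ContinuousAt U r := by
    have h1 : ∀ᶠ r in 𝓝 (s - P.D), r + P.D ∈ P.predInterval T := by
      have : Tendsto (fun r => r + P.D) (𝓝 (s - P.D)) (𝓝 s) := by
        have : ContinuousAt (fun r => r + P.D) (s - P.D) := by fun_prop
        simpa [ContinuousAt] using this
      exact this (predInterval_mem_nhds hs hDs)
    filter_upwards [h1, lt_mem_nhds h0] with r hr hr0
    simpa using hsol.continuousAt_U hn hh hD hr (by linarith)
  have := Plant.hasDerivAt_responseZ (x₀ := x₀) (v₀ := v₀) hD h0 (hsol.U_int _ h0.le hs.2) hev hp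
  rw [sub_add_cancel] at this
  refine this.congr_deriv ?_
  split_ifs with hpn
  · subst hpn
    rw [← P.mul_K_add_G0 hb.ne', hsol.U_sub_eq hD hs]
    have hv := hh.deriv_ne_zero (P.responseZ U x₀ v₀ s 1) s (hD.le.trans hs.1)
    field_simp
    ring
  · rw [add_zero, responseZ_succ (by omega)]

end IsClosedLoop

end Plant

end DelaySafe

/-! ### Boundedness and convergence of the tracking error. -/

open DelaySafe DelaySafe.Plant in
theorem mainTheorem9 {n m nd nr : ℕ} (hn : 1 ≤ n) (P : DelaySafe.Plant n m nd nr)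
    (hb : 0 < P.b) (hD : 0 < P.D) (hS : P.ExoOscillatory)
    (h : ℝ → ℝ → ℝ) (hh : DelaySafe.IsBarrier n h)
    (ε tbar : ℝ) (hε : 0 < ε) (htbar : 0 < tbar)
    (x₀ : Fin n → ℝ) (v₀ : Fin nd ⊕ Fin nr → ℝ)
    (k : ℕ → ℝ) (hkpos : ∀ i : ℕ, 1 ≤ i → i ≤ n → 0 < k i)
    (hk : ∀ i : ℕ, 1 ≤ i → i ≤ n - 1 →
      max 0 (P.kHat h (P.varsigma h ε tbar x₀ v₀) k x₀ v₀ i) ≤ k i)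
    (T : EReal) (X : ℝ → Fin n → ℝ) (V : ℝ → Fin nd ⊕ Fin nr → ℝ) (U : ℝ → ℝ)
    (hsol : P.IsClosedLoop h k ε tbar x₀ v₀ T X V U) :
    (∃ M : ℝ, ∀ t : ℝ, 0 ≤ t → (t : EReal) < T →
      ‖X t‖ ≤ M ∧ ‖V t‖ ≤ M ∧ ∀ x ∈ Set.Icc (0 : ℝ) 1, |P.actuator U x t| ≤ M) ∧
    (T = ⊤ → Filter.Tendsto (fun t => P.err (X t) (V t)) Filter.atTop (nhds 0)) := by
  have hle : ∀ s ∈ P.predInterval T, P.D ≤ s := fun s hs => hs.1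
  obtain ⟨l, hl, hdec⟩ := exists_cbf_decay hn hh (σ := P.varsigma h ε tbar x₀ v₀)
    contDiff_varsigma varsigma_eq_zero hkpos hD hle (fun s hs => Icc_subset_predInterval hs)
    (hsol.continuousOn_responseZ hD)
    fun s hs hDs p hp => hsol.hasDerivAt_responseZ hn hh hb hD hs hDs hp
  refine ⟨?_, fun hT => ?_⟩
  · obtain ⟨Mz, hMz⟩ := exists_bound_of_cbf_bound (k := k) (z := P.responseZ U x₀ v₀) hn hh
      (σ := P.varsigma h ε tbar x₀ v₀) contDiff_varsigma varsigma_eq_zero hD hle fun i hi => by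
        obtain ⟨C, hC, hCs⟩ := hdec i hi
        refine ⟨C, fun s hs => (hCs s hs).trans ?_⟩
        refine mul_le_of_le_one_right hC (Real.exp_le_one_iff.2 ?_)
        have := mul_nonneg hl.le (sub_nonneg.2 hs.1)
        linarith
    obtain ⟨Mv, hMv⟩ : ∃ C, ∀ s : ℝ, ‖P.expS s *ᵥ v₀‖ ≤ C := exists_bound_exp_mulVec P.S hS.1 hS.2 v₀
    have hMv0 : 0 ≤ Mv := (norm_nonneg _).trans (hMv 0)
    obtain ⟨Mx, hMx⟩ : ∃ C, ∀ s ∈ P.predInterval T, ‖P.response U x₀ v₀ s‖ ≤ C := by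
      obtain ⟨c, hc, hcb⟩ := exists_mulVec_bound P.Tz⁻¹
      obtain ⟨d, hd, hdb⟩ := exists_mulVec_bound P.Tv
      refine ⟨c * (Mz + d * Mv), fun s hs => ?_⟩
      have hz : ‖P.Tz *ᵥ P.response U x₀ v₀ s + P.Tv *ᵥ (P.expS s *ᵥ v₀)‖ ≤ Mz := by
        refine (pi_norm_le_iff_of_nonneg ((abs_nonneg _).trans (hMz s hs).1)).2 fun i => ?_
        rw [P.Tz_mulVec_add_Tv_mulVec, ← responseZ_succ i.2]
        exact (hMz s hs).2 _ (Finset.mem_Icc.2 ⟨by omega, i.2⟩)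
      -- The state is recovered from `Z` and `V` by inverting the unit triangular `T_z`.
      have e : P.response U x₀ v₀ s = P.Tz⁻¹ *ᵥ
          ((P.Tz *ᵥ P.response U x₀ v₀ s + P.Tv *ᵥ (P.expS s *ᵥ v₀))
            - P.Tv *ᵥ (P.expS s *ᵥ v₀)) := by
        rw [add_sub_cancel_right, mulVec_mulVec, nonsing_inv_mul _ isUnit_det_Tz, one_mulVec]
      rw [e]
      refine (hcb _).trans (mul_le_mul_of_nonneg_left ((norm_sub_le _ _).trans
        (add_le_add hz ((hdb _).trans ?_))) hc)
      exact mul_le_mul_of_nonneg_left (hMv s) hd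
    obtain ⟨Mu, hMu⟩ : ∃ C, ∀ s ∈ P.predInterval T, |U (s - P.D)| ≤ C := by
      obtain ⟨c, hc, hcb⟩ := exists_dotProduct_bound P.K
      obtain ⟨d, hd, hdb⟩ := exists_dotProduct_bound P.G0
      obtain ⟨r, hr⟩ := (IsClosedLoop.isTame_cbfRest_varsigma (k := k) (ε := ε) (tbar := tbar)
        (x₀ := x₀) (v₀ := v₀) (P := P) hn hh).bdd Mz
      obtain ⟨q, hq, hqb⟩ := hh.deriv_away Mz
      refine ⟨c * Mx + d * Mv + |1 / P.b| * r / q, fun s hs => ?_⟩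
      have hs0 : 0 < s := hD.trans_le hs.1
      rw [hsol.U_sub_eq hD hs]
      have h1 := (hcb (P.response U x₀ v₀ s)).trans (mul_le_mul_of_nonneg_left (hMx s hs) hc)
      have h2 := (hdb (P.expS s *ᵥ v₀)).trans (mul_le_mul_of_nonneg_left (hMv s) hd)
      have h3 := hr _ s hs0 (hMz s hs).1 (hMz s hs).2
      have h4 := hqb _ s ((hMz s hs).2 1 (Finset.mem_Icc.2 ⟨le_rfl, hn⟩)) hs0.le
      refine (abs_sub _ _).trans (add_le_add ((abs_sub _ _).trans (add_le_add ?_ h2)) ?_)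
      · rwa [abs_neg]
      · rw [abs_div, abs_mul]
        have := (abs_nonneg _).trans h3
        gcongr
    -- Up to time `D` no input has arrived, and the response is bounded by compactness.
    obtain ⟨Mi, hMi⟩ := (isCompact_Icc (a := 0) (b := P.D)).exists_bound_of_continuousOn
      (f := P.response U x₀ v₀) (by
        have := Plant.continuousOn_response (P := P) (U := U) (x₀ := x₀) (v₀ := v₀) hD le_rfl
          (by simp)
        rwa [zero_add] at this)
    -- The `0` covers the part of the actuator that no input has reached yet.
    refine ⟨max (max Mx Mi) (max Mv (max Mu 0)), fun t ht htT => ⟨?_, ?_, fun x hx => ?_⟩⟩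
    · rw [hsol.X_eq hD ht htT]
      refine le_trans ?_ (le_max_left _ _)
      by_cases htD : t ≤ P.D
      · exact (hMi t ⟨ht, htD⟩).trans (le_max_right _ _)
      · exact (hMx t ⟨(not_le.1 htD).le, coe_lt_of_le (by linarith) htT⟩).trans (le_max_left _ _)
    · rw [hsol.V_eq ht htT]
      exact (hMv t).trans ((le_max_left _ _).trans (le_max_right _ _))
    · refine le_trans ?_ ((le_max_right _ _).trans (le_max_right _ _))
      rw [actuator]
      split_ifs with h0
      · have hxD : P.D * x ≤ P.D := mul_le_of_le_one_right hD.le hx.2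
        have := hMu (t - P.D + P.D * x + P.D) ⟨by linarith, coe_lt_of_le (by linarith) htT⟩
        rw [add_sub_cancel_right] at this
        exact this.trans (le_max_left _ _)
      · simp
  · subst hT
    have hmem : ∀ s, P.D ≤ s → s ∈ P.predInterval ⊤ := fun s hs => ⟨hs, EReal.coe_lt_top _⟩
    refine hh.tendsto_of_tendsto _ ?_
    obtain ⟨C, hC, hCs⟩ := hdec 0 (by omega)
    have hlim : Tendsto (fun s => C * Real.exp (-l * (s - P.D))) atTop (𝓝 0) := by
      have h1 : Tendsto (fun s => -l * (s - P.D)) atTop atBot :=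
        (tendsto_atTop_add_const_right _ (-P.D) tendsto_id).const_mul_atTop_of_neg (by linarith)
      simpa using (Real.tendsto_exp_atBot.comp h1).const_mul C
    refine squeeze_zero_norm' ?_ hlim
    obtain ⟨c, hc⟩ := varsigma_eq_zero (P := P) (h := h) (ε := ε) (tbar := tbar) (x₀ := x₀)
      (v₀ := v₀)
    -- Beyond `c` the recovery function vanishes, so the decaying `h_1` is `h(e, s)` itself.
    filter_upwards [eventually_ge_atTop P.D, eventually_gt_atTop c] with s hs hcs
    have hs0 : 0 ≤ s := hD.le.trans hs
    have := hCs s (hmem s hs)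
    rw [P.err_eq hn, hsol.X_eq hD hs0 (EReal.coe_lt_top _), hsol.V_eq hs0 (EReal.coe_lt_top _),
      ← responseZ_succ hn]
    simpa [cbf, hc s hcs] using this
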